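/- Let $(V,\langle\cdot,\cdot\rangle)$ be a $4$-dimensional real vector space with a non-degenerate symmetric bilinear form of signature $(2,2)$, and let $A\in\otimes^4V^*$ be an algebraic curvature tensor on $V$, i.e. $$A(x,y,z,v)=-A(y,x,z,v)=A(z,v,x,y),\qquad A(x,y,z,v)+A(y,z,x,v)+A(z,x,y,v)=0 .$$ The Jacobi operator $\mathcal J_A(x)$ is defined by $\langle\mathcal J_A(x)y,z\rangle=A(y,x,x,z)$. The model $\mathfrak M=(V,\langle\cdot,\cdot\rangle,A)$ is *null Jordan Osserman* if the Jordan normal form of $\mathcal J_A(v)$ is the same for all non-zero null vectors $v$ (those with $\langle v,v\rangle=0$). The tensor $A$ is of *Type Ia* if the Jordan normal form of $\mathcal J_A(x)$ restricted to $x^\perp$ is constant on the spacelike unit vectors ($\langle x,x\rangle=1$) and constant on the timelike unit vectors ($\langle x,x\rangle=-1$), and is in both cases a real diagonal matrix. Put $$A^0(x,y,z,v)=\langle y,z\rangle\langle x,v\rangle-\langle x,z\rangle\langle y,v\rangle,$$ and, for a skew-adjoint endomorphism $\Psi$ of $V$, $$A^\Psi(x,y,z,v)=\langle\Psi y,z\rangle\langle\Psi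 x,v\rangle-\langle\Psi x,z\rangle\langle\Psi y,v\rangle-2\langle\Psi x,y\rangle\langle\Psi z,v\rangle .$$ **Theorem.** $\mathfrak M$ is null Jordan Osserman if and only if $A$ is of Type Ia and one of the following holds: 1. There is a real constant $\kappa_0$ with $A=\kappa_0A^0$. 2. There are real constants $\kappa_0$ and $\kappa_J\neq0$ with $A=\kappa_0A^0+\kappa_JA^J$, where $J$ is an orthogonal complex structure on $V$ (a skew-adjoint endomorphism with $J^2=-\mathrm{id}$). 3. There is a real constant $\kappa_P\neq0$ with $A=\kappa_PA^P$, where $P$ is an adapted paracomplex structure on $V$ (a skew-adjoint endomorphism with $P^2=\mathrm{id}$). 4. There are real constants $\kappa_1,\kappa_2,\kappa_3$ with $\kappa_2\kappa_3(\kappa_2+\kappa_1)(\kappa_3+\kappa_1)>0$, such that $3\kappa_1,-3\kappa_2,-3\kappa_3$ are pairwise distinct, and $A=\kappa_1A^{\Psi_1}+\kappa_2A^{\Psi_2}+\kappa_3A^{\Psi_3}$, where $(\Psi_1,\Psi_2,\Psi_3)$ is a paraquaternionic structure on $V$ (skew-adjoint endomorphisms with $\Psi_1^2=-\mathrm{id}$,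 $\Psi_2^2=\Psi_3^2=\mathrm{id}$ and $\Psi_i\Psi_j+\Psi_j\Psi_i=0$ for $i\neq j$). -/

import Mathlib

noncomputable section

namespace NullOsserman

/-- Covariant `4`-tensors on `V`, i.e. elements of `⊗⁴ V*`. -/
abbrev Tensor4 (V : Type*) [AddCommGroup V] [Module ℝ V] : Type _ :=
  V →ₗ[ℝ] V →ₗ[ℝ] V →ₗ[ℝ] V →ₗ[ℝ] ℝ

/-- Algebraic curvature tensors: `4`-tensors with the symmetries of the Riemann curvature tensor. -/
structure IsAlgebraicCurvatureTensor {V : Type*} [AddCommGroup V] [Module ℝ V]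
    (A : Tensor4 V) : Prop where
  skew : ∀ x y z v, A x y z v = -A y x z v
  pair : ∀ x y z v, A x y z v = A z v x y
  bianchi : ∀ x y z v, A x y z v + A y z x v + A z x y v = 0

/-- A model `(V, ⟨·,·⟩, A)`: a non-degenerate symmetric bilinear form and an algebraic
curvature tensor on a real vector space. -/
structure Model (V : Type*) [AddCommGroup V] [Module ℝ V] where
  /-- the inner product `⟨·,·⟩` -/
  form : LinearMap.BilinForm ℝ V
  form_symm : form.IsSymm
  form_nondegenerate : form.Nondegenerate
  /-- the curvature tensor `A` -/
  curv : Tensor4 V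
  curv_isCurvature : IsAlgebraicCurvatureTensor curv

/-- The tensor `A⁰(x,y,z,v) = ⟨y,z⟩⟨x,v⟩ - ⟨x,z⟩⟨y,v⟩` of constant sectional curvature `+1`. -/
def constCurv {V : Type*} [AddCommGroup V] [Module ℝ V] (g : LinearMap.BilinForm ℝ V) :
    Tensor4 V :=
  LinearMap.mk₂ ℝ
    (fun x y => LinearMap.mk₂ ℝ (fun z v => g y z * g x v - g x z * g y v)
      (by intros; simp; ring) (by intros; simp; ring)
      (by intros; simp; ring) (by intros; simp; ring))
    (by intros; ext; simp; ring) (by intros; ext; simp; ring)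
    (by intros; ext; simp; ring) (by intros; ext; simp; ring)

/-- The tensor
`A^Ψ(x,y,z,v) = ⟨Ψy,z⟩⟨Ψx,v⟩ - ⟨Ψx,z⟩⟨Ψy,v⟩ - 2⟨Ψx,y⟩⟨Ψz,v⟩` of an endomorphism `Ψ`. -/
def endoCurv {V : Type*} [AddCommGroup V] [Module ℝ V] (g : LinearMap.BilinForm ℝ V)
    (Ψ : V →ₗ[ℝ] V) : Tensor4 V :=
  LinearMap.mk₂ ℝ
    (fun x y => LinearMap.mk₂ ℝ
      (fun z v => g (Ψ y) z * g (Ψ x) v - g (Ψ x) z * g (Ψ y) v - 2 * g (Ψ x) y * g (Ψ z) v)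
      (by intros; simp; ring) (by intros; simp; ring)
      (by intros; simp; ring) (by intros; simp; ring))
    (by intros; ext; simp; ring) (by intros; ext; simp; ring)
    (by intros; ext; simp; ring) (by intros; ext; simp; ring)

/-- `Ψ` is an orthogonal complex structure: skew-adjoint with `Ψ² = -id`. -/
def IsOrthogonalComplex {V : Type*} [AddCommGroup V] [Module ℝ V]
    (g : LinearMap.BilinForm ℝ V) (Ψ : V →ₗ[ℝ] V) : Prop :=
  g.IsSkewAdjoint Ψ ∧ Ψ ∘ₗ Ψ = -LinearMap.id

/-- `Ψ` is an adapted paracomplex structure: skew-adjoint with `Ψ² = id`. -/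
def IsAdaptedParacomplex {V : Type*} [AddCommGroup V] [Module ℝ V]
    (g : LinearMap.BilinForm ℝ V) (Ψ : V →ₗ[ℝ] V) : Prop :=
  g.IsSkewAdjoint Ψ ∧ Ψ ∘ₗ Ψ = LinearMap.id

/-- `(Ψ₁, Ψ₂, Ψ₃)` is a paraquaternionic structure: skew-adjoint, `Ψ₁² = -id`,
`Ψ₂² = Ψ₃² = id`, and pairwise anti-commuting. -/
structure IsParaquaternionic {V : Type*} [AddCommGroup V] [Module ℝ V]
    (g : LinearMap.BilinForm ℝ V) (Ψ₁ Ψ₂ Ψ₃ : V →ₗ[ℝ] V) : Prop where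
  complex₁ : IsOrthogonalComplex g Ψ₁
  para₂ : IsAdaptedParacomplex g Ψ₂
  para₃ : IsAdaptedParacomplex g Ψ₃
  anti₁₂ : Ψ₁ ∘ₗ Ψ₂ + Ψ₂ ∘ₗ Ψ₁ = 0
  anti₁₃ : Ψ₁ ∘ₗ Ψ₃ + Ψ₃ ∘ₗ Ψ₁ = 0
  anti₂₃ : Ψ₂ ∘ₗ Ψ₃ + Ψ₃ ∘ₗ Ψ₂ = 0

/-- Two endomorphisms of a finite dimensional space have the same Jordan normal form, that is,
they are conjugate. -/
def SameJordanForm {V : Type*} [AddCommGroup V] [Module ℝ V] (S T : V →ₗ[ℝ] V) : Prop :=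
  ∃ φ : V ≃ₗ[ℝ] V, (φ : V →ₗ[ℝ] V) ∘ₗ S = T ∘ₗ (φ : V →ₗ[ℝ] V)

namespace Model

/-- Signature `(p, q)`: `p` timelike (negative) and `q` spacelike (positive) directions. -/
def HasSignature {V : Type*} [AddCommGroup V] [Module ℝ V] (M : Model V) (p q : ℕ) : Prop :=
  sigNeg (LinearMap.BilinMap.toQuadraticMap M.form) = p ∧
    sigPos (LinearMap.BilinMap.toQuadraticMap M.form) = q

/-- The set of spacelike unit vectors. -/
def spacelikeSphere {V : Type*} [AddCommGroup V] [Module ℝ V] (M : Model V) : Set V :=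
  {x | M.form x x = 1}

/-- The set of timelike unit vectors. -/
def timelikeSphere {V : Type*} [AddCommGroup V] [Module ℝ V] (M : Model V) : Set V :=
  {x | M.form x x = -1}

/-- The null cone: the set of non-zero null vectors. -/
def nullCone {V : Type*} [AddCommGroup V] [Module ℝ V] (M : Model V) : Set V :=
  {x | x ≠ 0 ∧ M.form x x = 0}

/-- The Jacobi operator `𝒥_A(x)`, characterized by `⟨𝒥_A(x) y, z⟩ = A(y, x, x, z)`
(see `form_jacobi`). -/
def jacobi {V : Type*} [AddCommGroup V] [Module ℝ V] [FiniteDimensional ℝ V]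
    (M : Model V) (x : V) : V →ₗ[ℝ] V :=
  (M.form.toDual M.form_nondegenerate).symm.toLinearMap ∘ₗ ((M.curv.flip x).flip x)

theorem form_jacobi {V : Type*} [AddCommGroup V] [Module ℝ V] [FiniteDimensional ℝ V]
    (M : Model V) (x y z : V) : M.form (M.jacobi x y) z = M.curv y x x z := by
  simp [jacobi]

/-- The orthogonal complement `x^⊥`. -/
def perp {V : Type*} [AddCommGroup V] [Module ℝ V] (M : Model V) (x : V) : Submodule ℝ V :=
  LinearMap.ker (M.form x)

theorem jacobi_mem_perp {V : Type*} [AddCommGroup V] [Module ℝ V] [FiniteDimensional ℝ V]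
    (M : Model V) (x y : V) : M.jacobi x y ∈ M.perp x := by
  have h1 : M.form x (M.jacobi x y) = M.curv y x x x := by
    rw [← M.form_jacobi x y x]; exact M.form_symm.eq _ _
  have h2 := M.curv_isCurvature.pair y x x x
  have h3 := M.curv_isCurvature.skew x x y x
  rw [perp, LinearMap.mem_ker, h1]
  linarith

/-- The Jacobi operator `𝒥_A(x)` restricted to `x^⊥`. -/
def jacobiPerp {V : Type*} [AddCommGroup V] [Module ℝ V] [FiniteDimensional ℝ V]
    (M : Model V) (x : V) : M.perp x →ₗ[ℝ] M.perp x :=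
  (M.jacobi x).restrict (fun y _ => M.jacobi_mem_perp x y)

/-- `M` is null Jordan Osserman: the Jordan normal form of the Jacobi operator is constant on the
null cone. -/
def IsNullJordanOsserman {V : Type*} [AddCommGroup V] [Module ℝ V] [FiniteDimensional ℝ V]
    (M : Model V) : Prop :=
  ∀ v ∈ M.nullCone, ∀ w ∈ M.nullCone, SameJordanForm (M.jacobi v) (M.jacobi w)

/-- On the set `S` of unit vectors, the Jordan normal form of `𝒥_A(x)` restricted to `x^⊥` is
constant and equal to `diag(α, β, γ)` for some real `α`, `β`, `γ`. -/
def IsDiagonalOn {V : Type*} [AddCommGroup V] [Module ℝ V] [FiniteDimensional ℝ V]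
    (M : Model V) (S : Set V) : Prop :=
  ∃ α β γ : ℝ, ∀ x ∈ S, ∃ b : Module.Basis (Fin 3) ℝ (M.perp x),
    LinearMap.toMatrix b b (M.jacobiPerp x) = Matrix.diagonal ![α, β, γ]

/-- `A` is of Type Ia: on the spacelike and on the timelike unit vectors `x`, the Jordan normal
form of `𝒥_A(x)` restricted to `x^⊥` is constant and is a real diagonal matrix. -/
def IsTypeIa {V : Type*} [AddCommGroup V] [Module ℝ V] [FiniteDimensional ℝ V]
    (M : Model V) : Prop :=
  M.IsDiagonalOn M.spacelikeSphere ∧ M.IsDiagonalOn M.timelikeSphere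

end Model

end NullOsserman

end

open Module

namespace NullOsserman

variable {V : Type*} [AddCommGroup V] [Module ℝ V]

/-! A null frame identifies `V` with `ℝ² ⊗ ℝ²`, the null vectors being the decomposable tensors;
fixing either factor gives one of two families of null planes.

Necessity. Since `𝒥(2v) = 4 𝒥(v)`, constancy of the Jordan form forces `tr 𝒥(v) = tr 𝒥(v)² = 0` on
the null cone. The first identity is the Einstein condition. The second says that a product of two
binary quartics in independent variables, one for each half of the Weyl tensor, is zero, so one of
them vanishes identically (`curv_mul_curv`, `IsNullJordanOsserman.exists_isNullFrame`). These are 9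
+ 5 linear conditions on the 20 components of `A`; the six that remain form a symmetric matrix `m`
with `A = ∑ mᵢⱼ A^{Ψᵢ,Ψⱼ}`, where `Ψ` is the paraquaternionic structure acting on one factor
(`exists_quadCurv`). Changes of paraquaternionic frame act on `m` as the isometries of the Lorentz
form on `ℝ³`, so the task is to diagonalize `m` relative to that form.

For null `v` there is a null `n` in `ℝ³` with `∑ nᵢ Ψᵢ v = 0`, and the nullity of `𝒥(v)` is governed
by the degeneracy of `m` on the annihilator of `n`. All null lines arise from the null vectors of a
single plane, and constant nullity leaves two cases. If `m` is non-degenerate on every annihilator,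
its determinant there has constant sign on the circle of null lines; this makes `m` diagonalizable
and gives the inequality of case 4, or case 2 when `κ₂ = κ₃`, by `3A⁰ = A^{Ψ₁} - A^{Ψ₂} - A^{Ψ₃}`.
If `m` is degenerate on every annihilator, its adjugate vanishes on the null cone, so `m` is a
multiple of the Lorentz form or of a square `l ⊗ l`; here `l` is not null when the multiple is
non-zero, since otherwise some but not all Jacobi operators would vanish. This gives cases 1, 3, and
2 with `κ₀ = 0`. Type Ia is then automatic: for non-null `x` the vectors `Ψᵢ x` are an orthogonal
eigenbasis of `x^⊥`.

Sufficiency. In each case `𝒥(v)` for null `v` is built from vectors spanning an isotropic line or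
plane, hence squares to zero, and a square-zero operator is determined up to conjugacy by its
nullity. In case 4 the inequality is what keeps the nullity constant. -/

@[simp]
theorem constCurv_apply (g : LinearMap.BilinForm ℝ V) (x y z v : V) :
    constCurv g x y z v = g y z * g x v - g x z * g y v := by
  simp [constCurv]

@[simp]
theorem endoCurv_apply (g : LinearMap.BilinForm ℝ V) (Ψ : V →ₗ[ℝ] V) (x y z v : V) :
    endoCurv g Ψ x y z v =
      g (Ψ y) z * g (Ψ x) v - g (Ψ x) z * g (Ψ y) v - 2 * g (Ψ x) y * g (Ψ z) v := by
  simp [endoCurv]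

theorem skewAdjoint_apply {g : LinearMap.BilinForm ℝ V} {Ψ : V →ₗ[ℝ] V}
    (h : g.IsSkewAdjoint Ψ) (x y : V) : g (Ψ x) y = -g x (Ψ y) := by
  simpa using h x y

theorem isSkewAdjoint_of_apply {g : LinearMap.BilinForm ℝ V} {Ψ : V →ₗ[ℝ] V}
    (h : ∀ x y, g (Ψ x) y = -g x (Ψ y)) : g.IsSkewAdjoint Ψ := by
  intro x y
  simpa using h x y

theorem form_skewAdjoint_self {g : LinearMap.BilinForm ℝ V} (hg : g.IsSymm) {Ψ : V →ₗ[ℝ] V}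
    (h : g.IsSkewAdjoint Ψ) (x : V) : g (Ψ x) x = 0 := by
  have h1 := skewAdjoint_apply h x x
  have h2 := hg.eq x (Ψ x)
  linarith

/-! ### Null frames -/

/-- A null frame of a neutral four-dimensional space: two hyperbolic pairs `(b 0, b 3)` and
`(b 1, -b 2)` that are orthogonal to each other. -/
def IsNullFrame (g : LinearMap.BilinForm ℝ V) (b : Fin 4 → V) : Prop :=
  ∀ i j, g (b i) (b j) = !![0, 0, 0, 1; 0, 0, -1, 0; 0, -1, 0, 0; 1, 0, 0, 0] i j

namespace IsNullFrame

variable {g : LinearMap.BilinForm ℝ V} {b : Fin 4 → V}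

theorem linearIndependent (h : IsNullFrame g b) : LinearIndependent ℝ b := by
  rw [Fintype.linearIndependent_iff]
  intro c hc
  have key : ∀ j, g (∑ i, c i • b i) (b j) = 0 := fun j => by simp [hc]
  have h0 := key 0
  have h1 := key 1
  have h2 := key 2
  have h3 := key 3
  simp [Fin.sum_univ_four, h _ _] at h0 h1 h2 h3
  intro i
  fin_cases i <;> simp_all

/-- The basis underlying a null frame. -/
noncomputable def basis (h : IsNullFrame g b) (hdim : finrank ℝ V = 4) : Basis (Fin 4) ℝ V :=
  basisOfLinearIndependentOfCardEqFinrank h.linearIndependent (by simp [hdim])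

@[simp]
theorem coe_basis (h : IsNullFrame g b) (hdim : finrank ℝ V = 4) : ⇑(h.basis hdim) = b := by
  simp [basis]

theorem repr_eq (h : IsNullFrame g b) (hdim : finrank ℝ V = 4) (x : V) :
    ⇑((h.basis hdim).repr x) = ![g x (b 3), -g x (b 2), -g x (b 1), g x (b 0)] := by
  have hx := (h.basis hdim).sum_repr x
  rw [coe_basis] at hx
  have key : ∀ j, g (∑ i, (h.basis hdim).repr x i • b i) (b j) = g x (b j) := fun j => by rw [hx]
  have h0 := key 0
  have h1 := key 1
  have h2 := key 2
  have h3 := key 3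
  simp [Fin.sum_univ_four, h _ _] at h0 h1 h2 h3
  ext i
  fin_cases i
  · simpa using h3
  · simp [← h2]
  · simp [← h1]
  · simpa using h0

theorem eq_sum (h : IsNullFrame g b) (hdim : finrank ℝ V = 4) (x : V) :
    x = g x (b 3) • b 0 - g x (b 2) • b 1 - g x (b 1) • b 2 + g x (b 0) • b 3 := by
  have hx := (h.basis hdim).sum_repr x
  rw [coe_basis, Fin.sum_univ_four, repr_eq] at hx
  rw [← sub_eq_zero]
  nth_rewrite 1 [← hx]
  simp
  module

theorem trace_eq (h : IsNullFrame g b) (hdim : finrank ℝ V = 4) (T : V →ₗ[ℝ] V) :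
    LinearMap.trace ℝ V T =
      g (T (b 0)) (b 3) - g (T (b 1)) (b 2) - g (T (b 2)) (b 1) + g (T (b 3)) (b 0) := by
  rw [LinearMap.trace_eq_matrix_trace ℝ (h.basis hdim), Matrix.trace, Fin.sum_univ_four]
  simp [LinearMap.toMatrix_apply, repr_eq]
  ring

theorem ext_endo (h : IsNullFrame g b) (hdim : finrank ℝ V = 4) {T U : V →ₗ[ℝ] V}
    (hTU : ∀ i, T (b i) = U (b i)) : T = U :=
  (h.basis hdim).ext fun i => by simpa using hTU i

theorem swap (h : IsNullFrame g b) : IsNullFrame g ![b 0, b 2, b 1, b 3] := by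
  intro i j
  fin_cases i <;> fin_cases j <;> simp [h _ _]

/-- Rotating the first tensor factor of `V ≅ ℝ² ⊗ ℝ²` by a matrix of determinant one. -/
theorem rotate (h : IsNullFrame g b) {α β γ δ : ℝ} (hdet : α * δ - β * γ = 1) :
    IsNullFrame g ![α • b 0 + γ • b 2, α • b 1 + γ • b 3, β • b 0 + δ • b 2, β • b 1 + δ • b 3] := by
  intro i j
  fin_cases i <;> fin_cases j <;> simp [h _ _] <;> linarith

end IsNullFrame

theorem Model.HasSignature.exists_isNullFrame [FiniteDimensional ℝ V] {M : Model V}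
    (h : M.HasSignature 2 2) : ∃ b, IsNullFrame M.form b := by
  obtain ⟨hneg, hpos⟩ := h
  obtain ⟨w, hw, hE⟩ := QuadraticForm.equivalent_one_zero_neg_one_weighted_sum_squared
    (LinearMap.BilinMap.toQuadraticMap M.form)
  rw [QuadraticForm.sigPos_of_equiv_weightedSumSquares hE, Set.ncard_eq_two] at hpos
  rw [QuadraticForm.sigNeg_of_equiv_weightedSumSquares hE, Set.ncard_eq_two] at hneg
  obtain ⟨e⟩ := hE
  obtain ⟨i, j, hij, hI⟩ := hpos
  obtain ⟨k, l, hkl, hK⟩ := hneg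
  have hi : w i = 1 := by
    have : 0 < w i := by have : i ∈ {i | 0 < w i} := by simp [hI]
                         exact this
    rcases hw i with h | h | h <;> linarith
  have hj : w j = 1 := by
    have : 0 < w j := by have : j ∈ {i | 0 < w i} := by simp [hI]
                         exact this
    rcases hw j with h | h | h <;> linarith
  have hk : w k = -1 := by
    have : w k < 0 := by have : k ∈ {i | w i < 0} := by simp [hK]
                         exact this
    rcases hw k with h | h | h <;> linarith
  have hl : w l = -1 := by
    have : w l < 0 := by have : l ∈ {i | w i < 0} := by simp [hK]
                         exact this
    rcases hw l with h | h | h <;> linarith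
  have hsymm := M.form_symm.eq
  have hQ : ∀ x, M.form (e.symm x) (e.symm x) = ∑ a, w a * (x a * x a) := fun x => by
    have h1 := e.symm.map_app x
    rw [LinearMap.BilinMap.toQuadraticMap_apply, QuadraticMap.weightedSumSquares_apply] at h1
    simpa only [smul_eq_mul] using h1
  have hB : ∀ x y, M.form (e.symm x) (e.symm y) = ∑ a, w a * (x a * y a) := fun x y => by
    have h1 := hQ (x + y)
    have e1 : e.symm (x + y) = e.symm x + e.symm y := map_add e.symm.toLinearEquiv x y
    have h2 := hsymm (e.symm x) (e.symm y)
    rw [e1] at h1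
    simp only [map_add, LinearMap.add_apply, hQ, Pi.add_apply] at h1
    have h3 : ∑ a, w a * ((x a + y a) * (x a + y a)) = ∑ a, w a * (x a * x a) +
        ∑ a, w a * (y a * y a) + 2 * ∑ a, w a * (x a * y a) := by
      rw [Finset.mul_sum, ← Finset.sum_add_distrib, ← Finset.sum_add_distrib]
      exact Finset.sum_congr rfl fun a _ => by ring
    linarith
  set E : Fin (finrank ℝ V) → V := fun a => e.symm (Pi.single a 1) with hEdef
  have hEE : ∀ a c, M.form (E a) (E c) = if a = c then w a else 0 := fun a c => by
    rw [hB]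
    rcases eq_or_ne a c with rfl | hac
    · simp [Pi.single_apply]
    · simp [Pi.single_apply, hac, hac.symm]
  have hik : i ≠ k := by rintro rfl; linarith
  have hil : i ≠ l := by rintro rfl; linarith
  have hjk : j ≠ k := by rintro rfl; linarith
  have hjl : j ≠ l := by rintro rfl; linarith
  -- Each hyperbolic pair combines one spacelike and one timelike basis vector. The factors `1/2`
  -- make the two pairings exactly `1` and `-1`.
  refine ⟨![(1 / 2 : ℝ) • (E i + E k), (1 / 2 : ℝ) • (E j + E l), E l - E j, E i - E k], ?_⟩
  intro a c
  fin_cases a <;> fin_cases c <;>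
    simp [hEE, hij, hij.symm, hkl, hkl.symm, hik, hik.symm, hil, hil.symm, hjk, hjk.symm,
      hjl, hjl.symm, hi, hj, hk, hl] <;> norm_num

/-! ### Square-zero endomorphisms -/

/-- The normal form of a square-zero endomorphism. -/
theorem exists_equiv_of_comp_self_eq_zero [FiniteDimensional ℝ V] {N : V →ₗ[ℝ] V}
    (hN : N ∘ₗ N = 0) {r k : ℕ} (hr : finrank ℝ (LinearMap.range N) = r)
    (hk : finrank ℝ V = r + r + k) :
    ∃ Θ : (((Fin r → ℝ) × (Fin r → ℝ)) × (Fin k → ℝ)) ≃ₗ[ℝ] V,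
      ∀ x, N (Θ x) = Θ ((0, x.1.1), 0) := by
  have hNN : ∀ x, N (N x) = 0 := fun x => LinearMap.congr_fun hN x
  have hle : LinearMap.range N ≤ LinearMap.ker N := by
    rintro _ ⟨y, rfl⟩
    exact hNN y
  have hrk := LinearMap.finrank_range_add_finrank_ker N
  obtain ⟨C, hC⟩ := (LinearMap.ker N).exists_isCompl
  obtain ⟨D, hD⟩ := (LinearMap.range N).exists_isCompl
  have hCr : finrank ℝ C = r := by
    have := Submodule.finrank_add_eq_of_isCompl hC
    omega
  -- `V = C ⊕ N(C) ⊕ K`: `C` complements the kernel, `N` maps it isomorphically onto the range, and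
  -- `K` complements the range inside the kernel.
  set K := D ⊓ LinearMap.ker N with hK
  have hKk : finrank ℝ K = k := by
    have h1 : LinearMap.range N ⊔ K = LinearMap.ker N := by
      rw [hK, ← sup_inf_assoc_of_le D hle, hD.sup_eq_top, top_inf_eq]
    have h2 : LinearMap.range N ⊓ K = ⊥ := by
      rw [hK, ← inf_assoc, hD.inf_eq_bot, bot_inf_eq]
    have h3 := Submodule.finrank_sup_add_finrank_inf_eq (LinearMap.range N) K
    rw [h1, h2, finrank_bot] at h3
    omega
  let eC : (Fin r → ℝ) ≃ₗ[ℝ] C := LinearEquiv.ofFinrankEq _ _ (by simp [hCr])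
  let eK : (Fin k → ℝ) ≃ₗ[ℝ] K := LinearEquiv.ofFinrankEq _ _ (by simp [hKk])
  let ιC : (Fin r → ℝ) →ₗ[ℝ] V := C.subtype ∘ₗ eC.toLinearMap
  let ιK : (Fin k → ℝ) →ₗ[ℝ] V := K.subtype ∘ₗ eK.toLinearMap
  let Θ : (((Fin r → ℝ) × (Fin r → ℝ)) × (Fin k → ℝ)) →ₗ[ℝ] V :=
    (ιC.coprod (N ∘ₗ ιC)).coprod ιK
  have hΘ : ∀ x, Θ x = ιC x.1.1 + N (ιC x.1.2) + ιK x.2 := fun x => by simp [Θ]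
  have hNK : ∀ x, N (ιK x) = 0 := fun x => (eK x).2.2
  have hNC : ∀ x, N (ιC x) = 0 → x = 0 := fun x hx => by
    have h1 : ιC x ∈ LinearMap.ker N ⊓ C := ⟨hx, (eC x).2⟩
    rw [hC.inf_eq_bot, Submodule.mem_bot] at h1
    have h2 : eC x = 0 := Subtype.ext h1
    simpa using h2
  have hinj : Function.Injective Θ := by
    rw [injective_iff_map_eq_zero]
    rintro ⟨⟨a, c⟩, d⟩ hx
    rw [hΘ] at hx
    have ha : a = 0 := hNC a (by simpa [hNN, hNK] using congrArg N hx)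
    subst ha
    simp only [map_zero, zero_add] at hx
    have hd : ιK d ∈ LinearMap.range N ⊓ D := by
      refine ⟨⟨-ιC c, ?_⟩, (eK d).2.1⟩
      rw [map_neg, ← sub_eq_zero]
      rw [← neg_eq_zero, ← hx]
      abel
    rw [hD.inf_eq_bot, Submodule.mem_bot] at hd
    rw [hd, add_zero] at hx
    have hc : c = 0 := hNC c hx
    have hd' : eK d = 0 := Subtype.ext hd
    have hd'' : d = 0 := by simpa using hd'
    simp [hc, hd'']
  refine ⟨LinearMap.linearEquivOfInjective Θ hinj (by simp [hk]), fun x => ?_⟩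
  simp [LinearMap.linearEquivOfInjective_apply, hΘ, hNN, hNK]

/-- All Jordan blocks have eigenvalue zero and size at most two, so the nullity fixes how many there
are of each size. -/
theorem sameJordanForm_of_comp_self_eq_zero [FiniteDimensional ℝ V] {S T : V →ₗ[ℝ] V}
    (hS : S ∘ₗ S = 0) (hT : T ∘ₗ T = 0)
    (h : finrank ℝ (LinearMap.ker S) = finrank ℝ (LinearMap.ker T)) : SameJordanForm S T := by
  have h1 := LinearMap.finrank_range_add_finrank_ker S
  have h2 := LinearMap.finrank_range_add_finrank_ker T
  have hle : LinearMap.range S ≤ LinearMap.ker S := by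
    rintro _ ⟨y, rfl⟩
    exact LinearMap.congr_fun hS y
  have h3 := Submodule.finrank_mono hle
  obtain ⟨k, hk⟩ := Nat.exists_eq_add_of_le
    (show finrank ℝ (LinearMap.range S) + finrank ℝ (LinearMap.range S) ≤ finrank ℝ V by omega)
  obtain ⟨Θ, hΘ⟩ := exists_equiv_of_comp_self_eq_zero hS rfl hk
  obtain ⟨Ξ, hΞ⟩ := exists_equiv_of_comp_self_eq_zero hT
    (show finrank ℝ (LinearMap.range T) = finrank ℝ (LinearMap.range S) by omega) hk
  refine ⟨Θ.symm.trans Ξ, LinearMap.ext fun x => ?_⟩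
  obtain ⟨y, rfl⟩ := Θ.surjective x
  simp [hΘ, hΞ]

theorem SameJordanForm.finrank_ker_eq {S T : V →ₗ[ℝ] V}
    (h : SameJordanForm S T) : finrank ℝ (LinearMap.ker S) = finrank ℝ (LinearMap.ker T) := by
  obtain ⟨φ, hφ⟩ := h
  have hφ' : ∀ x, φ (S x) = T (φ x) := fun x => LinearMap.congr_fun hφ x
  have : LinearMap.ker T = (LinearMap.ker S).map (φ : V →ₗ[ℝ] V) := by
    ext y
    constructor
    · intro hy
      refine ⟨φ.symm y, ?_, by simp⟩
      have := hφ' (φ.symm y)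
      rw [LinearEquiv.apply_symm_apply, LinearMap.mem_ker.1 hy] at this
      simpa using this
    · rintro ⟨x, hx, rfl⟩
      have := hφ' x
      rw [LinearMap.mem_ker.1 hx, map_zero] at this
      exact this.symm
  rw [this]
  exact (LinearEquiv.finrank_map_eq φ _).symm

theorem SameJordanForm.trace_eq {S T : V →ₗ[ℝ] V}
    (h : SameJordanForm S T) : LinearMap.trace ℝ V S = LinearMap.trace ℝ V T := by
  obtain ⟨φ, hφ⟩ := h
  rw [← LinearMap.trace_conj' S φ]
  congr 1
  ext x
  simpa [LinearEquiv.conj_apply] using LinearMap.congr_fun hφ (φ.symm x)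

theorem SameJordanForm.comp_self {S T : V →ₗ[ℝ] V}
    (h : SameJordanForm S T) : SameJordanForm (S ∘ₗ S) (T ∘ₗ T) := by
  obtain ⟨φ, hφ⟩ := h
  have hφ' : ∀ x, φ (S x) = T (φ x) := fun x => LinearMap.congr_fun hφ x
  exact ⟨φ, LinearMap.ext fun x => by simp [hφ']⟩

/-! ### Jacobi operators -/

namespace Model

variable (M : Model V)

theorem form_ext {x y : V} (h : ∀ z, M.form x z = M.form y z) : x = y := by
  rw [← sub_eq_zero]
  refine M.form_nondegenerate.1 _ fun z => ?_
  simp [h z]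

variable [FiniteDimensional ℝ V]

theorem jacobi_apply_eq {x y w : V} (h : ∀ z, M.form w z = M.curv y x x z) :
    M.jacobi x y = w :=
  M.form_ext fun z => by rw [form_jacobi, h]

theorem jacobi_smul (t : ℝ) (x : V) : M.jacobi (t • x) = (t ^ 2) • M.jacobi x := by
  ext y
  refine M.jacobi_apply_eq fun z => ?_
  simp [form_jacobi]
  ring

/-- The kernel of an operator that is a non-degenerate quadratic expression in the
functionals of two independent vectors has codimension two. -/
theorem finrank_ker_of_pair {a c : V} (hac : LinearIndependent ℝ ![a, c])
    (hdim : finrank ℝ V = 4) {T : V →ₗ[ℝ] V} {p q r : ℝ} (hdet : p * r - q ^ 2 ≠ 0)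
    (hT : ∀ y, T y = (p * M.form y a + q * M.form y c) • a +
      (q * M.form y a + r * M.form y c) • c) :
    finrank ℝ (LinearMap.ker T) = 2 := by
  have hker : LinearMap.ker T = M.form.orthogonal (Submodule.span ℝ (Set.range ![a, c])) := by
    ext y
    rw [LinearMap.mem_ker, hT, LinearMap.BilinForm.mem_orthogonal_iff]
    constructor
    · intro hy
      obtain ⟨h1, h2⟩ := LinearIndependent.pair_iff.1 hac _ _ hy
      have ha : M.form y a = 0 := by
        have : (p * r - q ^ 2) * M.form y a = 0 := by linear_combination r * h1 - q * h2
        simpa [hdet] using this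
      have hc : M.form y c = 0 := by
        have : (p * r - q ^ 2) * M.form y c = 0 := by linear_combination p * h2 - q * h1
        simpa [hdet] using this
      intro n hn
      have hle : Submodule.span ℝ (Set.range ![a, c]) ≤ LinearMap.ker (M.form y) := by
        rw [Submodule.span_le]
        rintro _ ⟨i, rfl⟩
        fin_cases i
        · simpa using ha
        · simpa using hc
      have := hle hn
      rw [LinearMap.mem_ker] at this
      rw [M.form_symm.eq, this]
    · intro hy
      have ha := hy a (Submodule.subset_span ⟨0, rfl⟩)
      have hc := hy c (Submodule.subset_span ⟨1, rfl⟩)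
      rw [M.form_symm.eq] at ha hc
      simp [ha, hc]
  rw [hker, LinearMap.BilinForm.finrank_orthogonal M.form_nondegenerate,
    finrank_span_eq_card hac, hdim]
  simp

theorem finrank_ker_of_single {a : V} (ha : a ≠ 0)
    (hdim : finrank ℝ V = 4) {T : V →ₗ[ℝ] V} {p : ℝ} (hp : p ≠ 0)
    (hT : ∀ y, T y = (p * M.form y a) • a) :
    finrank ℝ (LinearMap.ker T) = 3 := by
  have hker : LinearMap.ker T = M.form.orthogonal (Submodule.span ℝ {a}) := by
    ext y
    rw [LinearMap.mem_ker, hT, LinearMap.BilinForm.mem_orthogonal_iff]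
    constructor
    · intro hy n hn
      obtain ⟨t, rfl⟩ := Submodule.mem_span_singleton.1 hn
      have : M.form y a = 0 := by simpa [hp, ha] using hy
      rw [M.form_symm.eq]
      simp [this]
    · intro hy
      have ha := hy a (Submodule.mem_span_singleton_self a)
      rw [M.form_symm.eq] at ha
      simp [ha]
  rw [hker, LinearMap.BilinForm.finrank_orthogonal M.form_nondegenerate,
    finrank_span_singleton ha, hdim]

end Model

namespace IsParaquaternionic

variable {g : LinearMap.BilinForm ℝ V} {Ψ₁ Ψ₂ Ψ₃ : V →ₗ[ℝ] V}

theorem sq₁ (h : IsParaquaternionic g Ψ₁ Ψ₂ Ψ₃) (x : V) : Ψ₁ (Ψ₁ x) = -x :=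
  LinearMap.congr_fun h.complex₁.2 x

theorem sq₂ (h : IsParaquaternionic g Ψ₁ Ψ₂ Ψ₃) (x : V) : Ψ₂ (Ψ₂ x) = x :=
  LinearMap.congr_fun h.para₂.2 x

theorem sq₃ (h : IsParaquaternionic g Ψ₁ Ψ₂ Ψ₃) (x : V) : Ψ₃ (Ψ₃ x) = x :=
  LinearMap.congr_fun h.para₃.2 x

theorem comm₂₁ (h : IsParaquaternionic g Ψ₁ Ψ₂ Ψ₃) (x : V) : Ψ₂ (Ψ₁ x) = -Ψ₁ (Ψ₂ x) := by
  have := LinearMap.congr_fun h.anti₁₂ x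
  simp only [LinearMap.add_apply, LinearMap.comp_apply, LinearMap.zero_apply] at this
  exact eq_neg_of_add_eq_zero_right this

theorem comm₃₁ (h : IsParaquaternionic g Ψ₁ Ψ₂ Ψ₃) (x : V) : Ψ₃ (Ψ₁ x) = -Ψ₁ (Ψ₃ x) := by
  have := LinearMap.congr_fun h.anti₁₃ x
  simp only [LinearMap.add_apply, LinearMap.comp_apply, LinearMap.zero_apply] at this
  exact eq_neg_of_add_eq_zero_right this

theorem comm₃₂ (h : IsParaquaternionic g Ψ₁ Ψ₂ Ψ₃) (x : V) : Ψ₃ (Ψ₂ x) = -Ψ₂ (Ψ₃ x) := by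
  have := LinearMap.congr_fun h.anti₂₃ x
  simp only [LinearMap.add_apply, LinearMap.comp_apply, LinearMap.zero_apply] at this
  exact eq_neg_of_add_eq_zero_right this

end IsParaquaternionic

/-! ### Skew-adjoint structures with `Ψ² = ±id` -/

/-- Images under anti-commuting skew-adjoint maps are orthogonal. -/
theorem form_apply_apply_of_anti {g : LinearMap.BilinForm ℝ V} (hg : g.IsSymm)
    {Ψ Φ : V →ₗ[ℝ] V} (hΨ : g.IsSkewAdjoint Ψ) (hΦ : g.IsSkewAdjoint Φ)
    (h : ∀ x, Φ (Ψ x) = -Ψ (Φ x)) (x : V) : g (Ψ x) (Φ x) = 0 := by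
  have h1 := skewAdjoint_apply hΨ x (Φ x)
  have h2 := skewAdjoint_apply hΦ x (Ψ x)
  have h3 := hg.eq (Ψ x) (Φ x)
  rw [h, map_neg] at h2
  linarith

theorem form_apply_apply {g : LinearMap.BilinForm ℝ V}
    {Ψ : V →ₗ[ℝ] V} (hΨ : g.IsSkewAdjoint Ψ) {ε : ℝ} (h : ∀ x, Ψ (Ψ x) = ε • x) (x y : V) :
    g (Ψ x) (Ψ y) = -ε * g x y := by
  rw [skewAdjoint_apply hΨ, h, map_smul, smul_eq_mul, neg_mul]

theorem linearIndependent_complex {Ψ : V →ₗ[ℝ] V} (hsq : ∀ x, Ψ (Ψ x) = -x) {v : V}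
    (hv : v ≠ 0) : LinearIndependent ℝ ![v, Ψ v] := by
  rw [LinearIndependent.pair_iff]
  intro s t h
  have h2 := congrArg Ψ h
  rw [map_add, map_smul, map_smul, hsq, map_zero] at h2
  -- This multiplies the relation by the conjugate `s - tΨ`; the left side is its norm times `v`.
  have h3 : (s ^ 2 + t ^ 2) • v = s • (s • v + t • Ψ v) - t • (s • Ψ v + t • -v) := by module
  rw [h, h2, smul_zero, smul_zero, sub_zero] at h3
  have h4 : s ^ 2 + t ^ 2 = 0 := by simpa [hv] using h3
  constructor <;> nlinarith [sq_nonneg s, sq_nonneg t]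

/-! ### The four families are null Jordan Osserman, and Type Ia -/

namespace Model

variable [FiniteDimensional ℝ V] {M : Model V}

theorem isNullJordanOsserman_of_finrank_ker (d : ℕ)
    (hsq : ∀ v ∈ M.nullCone, M.jacobi v ∘ₗ M.jacobi v = 0)
    (hd : ∀ v ∈ M.nullCone, finrank ℝ (LinearMap.ker (M.jacobi v)) = d) :
    M.IsNullJordanOsserman := fun v hv w hw =>
  sameJordanForm_of_comp_self_eq_zero (hsq v hv) (hsq w hw) ((hd v hv).trans (hd w hw).symm)

theorem isNullJordanOsserman_of_single (hdim : finrank ℝ V = 4) {p : ℝ} {F : V →ₗ[ℝ] V}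
    (hF : ∀ v ∈ M.nullCone, F v ∈ M.nullCone)
    (hJ : ∀ v ∈ M.nullCone, ∀ y, M.jacobi v y = (p * M.form y (F v)) • F v) :
    M.IsNullJordanOsserman := by
  rcases eq_or_ne p 0 with rfl | hp
  · have h0 : ∀ v ∈ M.nullCone, M.jacobi v = 0 := fun v hv => LinearMap.ext fun y => by
      simp [hJ v hv]
    intro v hv w hw
    rw [h0 v hv, h0 w hw]
    exact ⟨LinearEquiv.refl ℝ V, by simp⟩
  · refine isNullJordanOsserman_of_finrank_ker 3 (fun v hv => LinearMap.ext fun y => ?_)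
      fun v hv => M.finrank_ker_of_single (hF v hv).1 hdim hp (hJ v hv)
    rw [LinearMap.comp_apply, hJ v hv, hJ v hv]
    simp [(hF v hv).2]

/-- The image of `𝒥(v)` lies in the isotropic plane of `a` and `c`, which `𝒥(v)` kills; so it
squares to zero. The determinant condition fixes the nullity at two, even though the coefficients
may vary with `v`. -/
theorem isNullJordanOsserman_of_pair (hdim : finrank ℝ V = 4)
    (hJ : ∀ v ∈ M.nullCone, ∃ (a c : V) (p q r : ℝ), LinearIndependent ℝ ![a, c] ∧
      p * r - q ^ 2 ≠ 0 ∧ M.form a a = 0 ∧ M.form a c = 0 ∧ M.form c c = 0 ∧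
      ∀ y, M.jacobi v y = (p * M.form y a + q * M.form y c) • a +
        (q * M.form y a + r * M.form y c) • c) :
    M.IsNullJordanOsserman := by
  refine isNullJordanOsserman_of_finrank_ker 2 (fun v hv => LinearMap.ext fun y => ?_)
      fun v hv => ?_
  · obtain ⟨a, c, p, q, r, -, -, haa, hac, hcc, h⟩ := hJ v hv
    have hca : M.form c a = 0 := by rw [M.form_symm.eq, hac]
    rw [LinearMap.comp_apply, h, h]
    simp [haa, hac, hcc, hca]
  · obtain ⟨a, c, p, q, r, hi, hdet, -, -, -, h⟩ := hJ v hv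
    exact M.finrank_ker_of_pair hi hdim hdet h

theorem isNullJordanOsserman_constCurv (hdim : finrank ℝ V = 4) {κ₀ : ℝ}
    (hA : M.curv = κ₀ • constCurv M.form) : M.IsNullJordanOsserman := by
  refine isNullJordanOsserman_of_single (p := -κ₀) (F := LinearMap.id) hdim (fun v hv => hv)
    fun v hv y => M.jacobi_apply_eq fun z => ?_
  simp [hA, hv.2]
  ring

theorem isNullJordanOsserman_paracomplex (hdim : finrank ℝ V = 4) {κP : ℝ} {P : V →ₗ[ℝ] V}
    (hP : IsAdaptedParacomplex M.form P) (hA : M.curv = κP • endoCurv M.form P) :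
    M.IsNullJordanOsserman := by
  have hsq : ∀ x, P (P x) = (1 : ℝ) • x := fun x => by
    rw [one_smul]
    exact LinearMap.congr_fun hP.2 x
  refine isNullJordanOsserman_of_single (p := 3 * κP) (F := P) hdim (fun v hv => ⟨?_, ?_⟩)
    fun v hv y => M.jacobi_apply_eq fun z => ?_
  · intro h0
    have := hsq v
    rw [h0, map_zero, one_smul] at this
    exact hv.1 this.symm
  · rw [form_apply_apply hP.1 hsq, hv.2, mul_zero]
  · have h1 := form_skewAdjoint_self M.form_symm hP.1 v
    have h2 := skewAdjoint_apply hP.1 y v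
    simp [hA, h1, h2]
    ring

theorem isNullJordanOsserman_complex (hdim : finrank ℝ V = 4) {κ₀ κJ : ℝ} {J : V →ₗ[ℝ] V}
    (hκ : κJ ≠ 0) (hJ : IsOrthogonalComplex M.form J)
    (hA : M.curv = κ₀ • constCurv M.form + κJ • endoCurv M.form J) :
    M.IsNullJordanOsserman := by
  have hsq : ∀ x, J (J x) = -x := fun x => LinearMap.congr_fun hJ.2 x
  have hsq' : ∀ x, J (J x) = (-1 : ℝ) • x := fun x => by rw [hsq, neg_one_smul]
  rcases eq_or_ne κ₀ 0 with rfl | h0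
  · refine isNullJordanOsserman_of_single (p := 3 * κJ) (F := J) hdim (fun v hv => ⟨?_, ?_⟩)
      fun v hv y => M.jacobi_apply_eq fun z => ?_
    · intro h0
      have := hsq v
      rw [h0, map_zero, zero_eq_neg] at this
      exact hv.1 this
    · rw [form_apply_apply hJ.1 hsq', hv.2, mul_zero]
    · have h1 := form_skewAdjoint_self M.form_symm hJ.1 v
      have h2 := skewAdjoint_apply hJ.1 y v
      simp [hA, h1, h2]
      ring
  · refine isNullJordanOsserman_of_pair hdim fun v hv =>
      ⟨v, J v, -κ₀, 0, 3 * κJ, linearIndependent_complex hsq hv.1, by simp [h0, hκ], hv.2, ?_, ?_,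
        fun y => M.jacobi_apply_eq fun z => ?_⟩
    · rw [M.form_symm.eq, form_skewAdjoint_self M.form_symm hJ.1]
    · rw [form_apply_apply hJ.1 hsq', hv.2, mul_zero]
    · have h1 := form_skewAdjoint_self M.form_symm hJ.1 v
      have h2 := skewAdjoint_apply hJ.1 y v
      simp [hA, h1, h2, hv.2]
      ring

theorem jacobi_paraquaternionic {κ₁ κ₂ κ₃ : ℝ} {Ψ₁ Ψ₂ Ψ₃ : V →ₗ[ℝ] V}
    (hΨ : IsParaquaternionic M.form Ψ₁ Ψ₂ Ψ₃)
    (hA : M.curv = κ₁ • endoCurv M.form Ψ₁ + κ₂ • endoCurv M.form Ψ₂ + κ₃ • endoCurv M.form Ψ₃)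
    (v y : V) : M.jacobi v y = (3 * κ₁ * M.form y (Ψ₁ v)) • Ψ₁ v +
      (3 * κ₂ * M.form y (Ψ₂ v)) • Ψ₂ v + (3 * κ₃ * M.form y (Ψ₃ v)) • Ψ₃ v := by
  refine M.jacobi_apply_eq fun z => ?_
  simp [hA, form_skewAdjoint_self M.form_symm hΨ.complex₁.1,
    form_skewAdjoint_self M.form_symm hΨ.para₂.1, form_skewAdjoint_self M.form_symm hΨ.para₃.1,
    skewAdjoint_apply hΨ.complex₁.1 y, skewAdjoint_apply hΨ.para₂.1 y,
    skewAdjoint_apply hΨ.para₃.1 y]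
  ring

/-- A vector orthogonal to an isotropic plane of a four-dimensional space lies in that plane. -/
theorem exists_eq_of_ortho (hdim : finrank ℝ V = 4) {a c w : V}
    (hac : LinearIndependent ℝ ![a, c]) (h₁ : M.form a a = 0) (h₂ : M.form a c = 0)
    (h₃ : M.form c c = 0) (ha : M.form a w = 0) (hc : M.form c w = 0) :
    ∃ p r : ℝ, w = p • a + r • c := by
  have h₂' : M.form c a = 0 := by rw [M.form_symm.eq, h₂]
  have hmem : ∀ x, M.form a x = 0 → M.form c x = 0 →
      x ∈ M.form.orthogonal (Submodule.span ℝ {a, c}) := by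
    intro x hax hcx n hn
    obtain ⟨s, t, rfl⟩ := Submodule.mem_span_pair.1 hn
    change M.form _ x = 0
    simp [hax, hcx]
  have hle : Submodule.span ℝ {a, c} ≤ M.form.orthogonal (Submodule.span ℝ {a, c}) := by
    rw [Submodule.span_le]
    rintro x (rfl | rfl)
    · exact hmem _ h₁ h₂'
    · exact hmem _ h₂ h₃
  have hfr : finrank ℝ (Submodule.span ℝ {a, c}) = 2 := by
    have := finrank_span_eq_card hac
    rwa [Matrix.range_cons, Matrix.range_cons, Matrix.range_empty, Set.union_empty,
      Set.singleton_union] at this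
  have heq := Submodule.eq_of_le_of_finrank_eq hle (by
    rw [LinearMap.BilinForm.finrank_orthogonal M.form_nondegenerate, hfr, hdim])
  have hw := hmem w ha hc
  rw [← heq] at hw
  obtain ⟨s, t, rfl⟩ := Submodule.mem_span_pair.1 hw
  exact ⟨s, t, rfl⟩

/-- The span of `v` and `Ψ₁ v` is isotropic and equals its own orthogonal complement, so it contains
`Ψ₂ v` and `Ψ₃ v`. Their coordinates `(p, r)` and `(p', r')` are orthonormal in `ℝ²`, which makes
the determinant of `𝒥(v)` on this plane a convex combination of two numbers of equal sign, up to the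
factor `9`. -/
theorem isNullJordanOsserman_paraquaternionic (hdim : finrank ℝ V = 4) {κ₁ κ₂ κ₃ : ℝ}
    {Ψ₁ Ψ₂ Ψ₃ : V →ₗ[ℝ] V} (hκ : 0 < κ₂ * κ₃ * (κ₂ + κ₁) * (κ₃ + κ₁))
    (hΨ : IsParaquaternionic M.form Ψ₁ Ψ₂ Ψ₃)
    (hA : M.curv = κ₁ • endoCurv M.form Ψ₁ + κ₂ • endoCurv M.form Ψ₂ +
      κ₃ • endoCurv M.form Ψ₃) :
    M.IsNullJordanOsserman := by
  refine isNullJordanOsserman_of_pair hdim fun v hv => ?_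
  have hi := linearIndependent_complex hΨ.sq₁ hv.1
  have h12 := form_apply_apply_of_anti M.form_symm hΨ.complex₁.1 hΨ.para₂.1 hΨ.comm₂₁ v
  have h13 := form_apply_apply_of_anti M.form_symm hΨ.complex₁.1 hΨ.para₃.1 hΨ.comm₃₁ v
  have h01 : M.form v (Ψ₁ v) = 0 := by
    rw [M.form_symm.eq, form_skewAdjoint_self M.form_symm hΨ.complex₁.1]
  have h02 : M.form v (Ψ₂ v) = 0 := by
    rw [M.form_symm.eq, form_skewAdjoint_self M.form_symm hΨ.para₂.1]
  have h03 : M.form v (Ψ₃ v) = 0 := by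
    rw [M.form_symm.eq, form_skewAdjoint_self M.form_symm hΨ.para₃.1]
  have h11 : M.form (Ψ₁ v) (Ψ₁ v) = 0 := by
    rw [skewAdjoint_apply hΨ.complex₁.1, hΨ.sq₁, map_neg, hv.2]; simp
  obtain ⟨p, r, h2⟩ := M.exists_eq_of_ortho hdim hi hv.2 h01 h11 h02 h12
  obtain ⟨p', r', h3⟩ := M.exists_eq_of_ortho hdim hi hv.2 h01 h11 h03 h13
  have e2 : p ^ 2 + r ^ 2 = 1 := by
    have := hΨ.sq₂ v
    rw [h2, map_add, map_smul, map_smul, hΨ.comm₂₁, h2, map_add, map_smul, map_smul, hΨ.sq₁,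
      ← sub_eq_zero] at this
    have h' : (p ^ 2 + r ^ 2 - 1) • v = 0 := by rw [← this]; module
    have : p ^ 2 + r ^ 2 - 1 = 0 := by simpa [hv.1] using h'
    linarith
  have e3 : p' ^ 2 + r' ^ 2 = 1 := by
    have := hΨ.sq₃ v
    rw [h3, map_add, map_smul, map_smul, hΨ.comm₃₁, h3, map_add, map_smul, map_smul, hΨ.sq₁,
      ← sub_eq_zero] at this
    have h' : (p' ^ 2 + r' ^ 2 - 1) • v = 0 := by rw [← this]; module
    have : p' ^ 2 + r' ^ 2 - 1 = 0 := by simpa [hv.1] using h'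
    linarith
  have e23 : p * p' + r * r' = 0 := by
    have := hΨ.comm₃₂ v
    rw [h2, h3, map_add, map_add, map_smul, map_smul, map_smul, map_smul, hΨ.comm₃₁, hΨ.comm₂₁,
      h2, h3, map_add, map_smul, map_smul, map_add, map_smul, map_smul, hΨ.sq₁,
      ← sub_eq_zero] at this
    have h' : (2 * (p * p' + r * r')) • v = 0 := by rw [← this]; module
    have : 2 * (p * p' + r * r') = 0 := by
      rcases smul_eq_zero.1 h' with h | h
      · exact h
      · exact absurd h hv.1
    linarith
  refine ⟨v, Ψ₁ v, 3 * (κ₂ * p ^ 2 + κ₃ * p' ^ 2), 3 * (κ₂ * (p * r) + κ₃ * (p' * r')),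
    3 * (κ₁ + κ₂ * r ^ 2 + κ₃ * r' ^ 2), hi, ?_, hv.2, h01, h11, fun y => ?_⟩
  -- Orthonormal rows in the plane: the second is the first rotated by a right angle, up to sign.
  · have hp' : p' ^ 2 = r ^ 2 := by
      linear_combination -(p' ^ 2) * e2 + (p * p' - r * r') * e23 + r ^ 2 * e3
    have hr' : r' ^ 2 = p ^ 2 := by linarith
    have hcross : (p * r' - p' * r) ^ 2 = 1 := by
      linear_combination e2 * (p' ^ 2 + r' ^ 2) + e3 - (p * p' + r * r') * e23
    have hD : 3 * (κ₂ * p ^ 2 + κ₃ * p' ^ 2) * (3 * (κ₁ + κ₂ * r ^ 2 + κ₃ * r' ^ 2)) -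
        (3 * (κ₂ * (p * r) + κ₃ * (p' * r'))) ^ 2 =
        9 * (κ₂ * (κ₃ + κ₁) * p ^ 2 + κ₃ * (κ₂ + κ₁) * r ^ 2) := by
      linear_combination 9 * κ₂ * κ₃ * hcross + 9 * κ₁ * κ₃ * hp' - 9 * κ₂ * κ₃ * e2
    rw [hD]
    intro h0
    -- The hypothesis says that the two weights of `p ^ 2` and `r ^ 2` are non-zero with the same
    -- sign, so the combination cannot vanish when `p ^ 2 + r ^ 2 = 1`.
    have hPQ : 0 < (κ₂ * (κ₃ + κ₁)) * (κ₃ * (κ₂ + κ₁)) := by linarith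
    set P := κ₂ * (κ₃ + κ₁)
    set Q := κ₃ * (κ₂ + κ₁)
    have h1 : P * p ^ 2 + Q * r ^ 2 = 0 := by linarith
    have h4 : P ^ 2 * p ^ 2 + P * Q * r ^ 2 = 0 := by linear_combination P * h1
    have hP2 : 0 < P ^ 2 := by
      have : P ≠ 0 := by rintro h; simp [h] at hPQ
      positivity
    rcases eq_or_ne r 0 with hr | hr
    · have hp : p ^ 2 = 1 := by rw [hr] at e2; linarith
      rw [hp, hr] at h4; linarith
    · have : 0 < P * Q * r ^ 2 := by positivity
      have : 0 ≤ P ^ 2 * p ^ 2 := by positivity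
      linarith
  · rw [jacobi_paraquaternionic hΨ hA, h2, h3]
    simp only [map_add, map_smul, smul_eq_mul]
    module

/-- The Jacobi operators of a combination of the curvature tensors of a paraquaternionic structure
have the same diagonal form at all vectors of a given non-zero square length. -/
theorem isDiagonalOn_paraquaternionic (hdim : finrank ℝ V = 4) {κ₁ κ₂ κ₃ ε : ℝ} (hε : ε ≠ 0)
    {Ψ₁ Ψ₂ Ψ₃ : V →ₗ[ℝ] V} (hΨ : IsParaquaternionic M.form Ψ₁ Ψ₂ Ψ₃)
    (hA : M.curv = κ₁ • endoCurv M.form Ψ₁ + κ₂ • endoCurv M.form Ψ₂ +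
      κ₃ • endoCurv M.form Ψ₃) :
    M.IsDiagonalOn {x | M.form x x = ε} := by
  -- The eigenvalue at `Ψᵢ x` is `3κᵢ⟨Ψᵢ x, Ψᵢ x⟩`; the sign changes because `Ψ₂` and `Ψ₃` reverse
  -- the form.
  refine ⟨3 * κ₁ * ε, -(3 * κ₂ * ε), -(3 * κ₃ * ε), fun x hx => ?_⟩
  have hx : M.form x x = ε := hx
  have h01 := form_skewAdjoint_self M.form_symm hΨ.complex₁.1 x
  have h02 := form_skewAdjoint_self M.form_symm hΨ.para₂.1 x
  have h03 := form_skewAdjoint_self M.form_symm hΨ.para₃.1 x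
  have h12 := form_apply_apply_of_anti M.form_symm hΨ.complex₁.1 hΨ.para₂.1 hΨ.comm₂₁ x
  have h13 := form_apply_apply_of_anti M.form_symm hΨ.complex₁.1 hΨ.para₃.1 hΨ.comm₃₁ x
  have h23 := form_apply_apply_of_anti M.form_symm hΨ.para₂.1 hΨ.para₃.1 hΨ.comm₃₂ x
  have h21 := (M.form_symm.eq (Ψ₂ x) (Ψ₁ x)).trans h12
  have h31 := (M.form_symm.eq (Ψ₃ x) (Ψ₁ x)).trans h13
  have h32 := (M.form_symm.eq (Ψ₃ x) (Ψ₂ x)).trans h23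
  have h11 : M.form (Ψ₁ x) (Ψ₁ x) = ε := by
    rw [skewAdjoint_apply hΨ.complex₁.1, hΨ.sq₁, map_neg, hx, neg_neg]
  have h22 : M.form (Ψ₂ x) (Ψ₂ x) = -ε := by
    rw [skewAdjoint_apply hΨ.para₂.1, hΨ.sq₂, hx]
  have h33 : M.form (Ψ₃ x) (Ψ₃ x) = -ε := by
    rw [skewAdjoint_apply hΨ.para₃.1, hΨ.sq₃, hx]
  have hperp : finrank ℝ (M.perp x) = 3 := by
    have h0 : M.form x ≠ 0 := fun h => hε (by rw [← hx, h]; rfl)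
    have := Module.Dual.finrank_ker_add_one_of_ne_zero h0
    rw [hdim] at this
    exact Nat.succ_injective this
  let f : Fin 3 → M.perp x := ![⟨Ψ₁ x, by rw [perp, LinearMap.mem_ker, M.form_symm.eq, h01]⟩,
    ⟨Ψ₂ x, by rw [perp, LinearMap.mem_ker, M.form_symm.eq, h02]⟩,
    ⟨Ψ₃ x, by rw [perp, LinearMap.mem_ker, M.form_symm.eq, h03]⟩]
  have hf : LinearIndependent ℝ f := by
    rw [Fintype.linearIndependent_iff]
    intro c hc
    have hc' : c 0 • Ψ₁ x + c 1 • Ψ₂ x + c 2 • Ψ₃ x = 0 := by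
      have := congrArg Subtype.val hc
      simpa [Fin.sum_univ_three, f] using this
    have k1 := congrArg (fun y => M.form y (Ψ₁ x)) hc'
    have k2 := congrArg (fun y => M.form y (Ψ₂ x)) hc'
    have k3 := congrArg (fun y => M.form y (Ψ₃ x)) hc'
    simp [h11, h12, h13, h21, h22, h23, h31, h32, h33, hε] at k1 k2 k3
    intro i
    fin_cases i <;> assumption
  let B := basisOfLinearIndependentOfCardEqFinrank hf (by simp [hperp])
  have hB : ⇑B = f := by simp [B]
  have hJ : ∀ i, M.jacobiPerp x (B i) =
      (![3 * κ₁ * ε, -(3 * κ₂ * ε), -(3 * κ₃ * ε)] i) • B i := by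
    intro i
    apply Subtype.ext
    rw [hB, jacobiPerp, LinearMap.coe_restrict_apply, jacobi_paraquaternionic hΨ hA]
    fin_cases i <;> simp [f, h11, h12, h13, h21, h22, h23, h31, h32, h33]
  refine ⟨B, ?_⟩
  ext i j
  rw [LinearMap.toMatrix_apply, hJ, map_smul, Basis.repr_self, Matrix.diagonal_apply]
  rcases eq_or_ne i j with rfl | hij
  · simp
  · simp [hij]

theorem isTypeIa_paraquaternionic (hdim : finrank ℝ V = 4) {κ₁ κ₂ κ₃ : ℝ}
    {Ψ₁ Ψ₂ Ψ₃ : V →ₗ[ℝ] V} (hΨ : IsParaquaternionic M.form Ψ₁ Ψ₂ Ψ₃)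
    (hA : M.curv = κ₁ • endoCurv M.form Ψ₁ + κ₂ • endoCurv M.form Ψ₂ +
      κ₃ • endoCurv M.form Ψ₃) : M.IsTypeIa :=
  ⟨isDiagonalOn_paraquaternionic hdim one_ne_zero hΨ hA,
    isDiagonalOn_paraquaternionic hdim (neg_ne_zero.2 one_ne_zero) hΨ hA⟩

end Model

/-! ### Symmetric matrices and the Lorentz form on `ℝ³` -/

/-- The Gram matrix of the Lorentz form on `ℝ³`. -/
def lorentz : Matrix (Fin 3) (Fin 3) ℝ := Matrix.diagonal ![1, -1, -1]

/-- The rows of `X` are an orthonormal frame of the Lorentz form. -/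
def IsLorentzFrame (X : Matrix (Fin 3) (Fin 3) ℝ) : Prop := X * lorentz * X.transpose = lorentz

/-- The Lorentz norm of a vector. -/
def lorentzNorm (x : Fin 3 → ℝ) : ℝ := x 0 ^ 2 - x 1 ^ 2 - x 2 ^ 2

/-- `m` is non-degenerate on the annihilators of all null lines. -/
def IsNullNondegenerate (m : Matrix (Fin 3) (Fin 3) ℝ) : Prop :=
  ∀ n u : Fin 3 → ℝ, ∀ μ : ℝ, n ≠ 0 → lorentzNorm n = 0 → u ≠ 0 → dotProduct u n = 0 →
    m.mulVec u ≠ μ • n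

theorem lorentz_mul_self : lorentz * lorentz = 1 := by
  ext i j
  fin_cases i <;> fin_cases j <;> simp [lorentz]

theorem lorentz_transpose : lorentz.transpose = lorentz := by
  simp [lorentz]

theorem dotProduct_lorentz (x : Fin 3 → ℝ) :
    dotProduct x (lorentz.mulVec x) = lorentzNorm x := by
  simp [lorentz, lorentzNorm, dotProduct, Fin.sum_univ_three, Matrix.mulVec_diagonal]
  ring

namespace IsLorentzFrame

variable {X Y : Matrix (Fin 3) (Fin 3) ℝ}

theorem of_rows (h₀₀ : X 0 0 ^ 2 - X 0 1 ^ 2 - X 0 2 ^ 2 = 1)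
    (h₁₁ : X 1 0 ^ 2 - X 1 1 ^ 2 - X 1 2 ^ 2 = -1) (h₂₂ : X 2 0 ^ 2 - X 2 1 ^ 2 - X 2 2 ^ 2 = -1)
    (h₀₁ : X 0 0 * X 1 0 - X 0 1 * X 1 1 - X 0 2 * X 1 2 = 0)
    (h₀₂ : X 0 0 * X 2 0 - X 0 1 * X 2 1 - X 0 2 * X 2 2 = 0)
    (h₁₂ : X 1 0 * X 2 0 - X 1 1 * X 2 1 - X 1 2 * X 2 2 = 0) : IsLorentzFrame X := by
  have key : ∀ i j, (X * lorentz * X.transpose) i j =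
      X i 0 * X j 0 - X i 1 * X j 1 - X i 2 * X j 2 := fun i j => by
    rw [Matrix.mul_apply, Fin.sum_univ_three, lorentz]
    simp only [Matrix.mul_diagonal, Matrix.transpose_apply]
    simp
    ring
  ext i j
  rw [key]
  fin_cases i <;> fin_cases j <;> simp [lorentz] <;> linarith

theorem one : IsLorentzFrame 1 := by
  simp [IsLorentzFrame]

theorem mul (hX : IsLorentzFrame X) (hY : IsLorentzFrame Y) : IsLorentzFrame (Y * X) := by
  have h : Y * X * lorentz * (Y * X).transpose =
      Y * (X * lorentz * X.transpose) * Y.transpose := by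
    simp only [Matrix.transpose_mul, Matrix.mul_assoc]
  rw [IsLorentzFrame, h, hX, hY]

theorem mul_inv (hX : IsLorentzFrame X) : X * (lorentz * X.transpose * lorentz) = 1 := by
  have h : X * (lorentz * X.transpose * lorentz) = X * lorentz * X.transpose * lorentz := by
    simp only [Matrix.mul_assoc]
  rw [h, hX, lorentz_mul_self]

theorem inv_mul (hX : IsLorentzFrame X) : (lorentz * X.transpose * lorentz) * X = 1 :=
  mul_eq_one_comm.1 hX.mul_inv

theorem transpose_mul (hX : IsLorentzFrame X) : X.transpose * (lorentz * X * lorentz) = 1 := by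
  have := congrArg Matrix.transpose hX.inv_mul
  simpa only [Matrix.transpose_mul, Matrix.transpose_transpose, lorentz_transpose,
    Matrix.transpose_one, Matrix.mul_assoc] using this

theorem exists_eq (hX : IsLorentzFrame X) (m : Matrix (Fin 3) (Fin 3) ℝ) (hm : m.IsSymm) :
    ∃ m' : Matrix (Fin 3) (Fin 3) ℝ, m'.IsSymm ∧ m = X.transpose * m' * X := by
  refine ⟨(lorentz * X * lorentz) * m * (lorentz * X.transpose * lorentz), ?_, ?_⟩
  · rw [Matrix.IsSymm]
    simp only [Matrix.transpose_mul, Matrix.transpose_transpose, lorentz_transpose, hm.eq,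
      Matrix.mul_assoc]
  · have h : X.transpose * ((lorentz * X * lorentz) * m * (lorentz * X.transpose * lorentz)) * X =
        (X.transpose * (lorentz * X * lorentz)) * m * ((lorentz * X.transpose * lorentz) * X) := by
      simp only [Matrix.mul_assoc]
    rw [h, hX.transpose_mul, hX.inv_mul, Matrix.one_mul, Matrix.mul_one]

/-- Null vectors `n` transform by `Xᵀ` and covectors `u` by `X⁻¹`, which preserves the pairing and
the Lorentz norm. -/
theorem isNullNondegenerate (hX : IsLorentzFrame X) {m : Matrix (Fin 3) (Fin 3) ℝ}
    (h : IsNullNondegenerate (X.transpose * m * X)) : IsNullNondegenerate m := by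
  intro n u μ hn hnull hu hun hm
  set Z := lorentz * X.transpose * lorentz with hZ
  have hXZ : X * Z = 1 := hX.mul_inv
  refine h (X.transpose.mulVec n) (Z.mulVec u) μ ?_ ?_ ?_ ?_ ?_
  · intro h0
    have := congrArg (fun w => Z.transpose.mulVec w) h0
    simp only [Matrix.mulVec_mulVec, Matrix.mulVec_zero] at this
    rw [← Matrix.transpose_mul, hXZ, Matrix.transpose_one, Matrix.one_mulVec] at this
    exact hn this
  · have h1 : lorentz.mulVec n = X.mulVec (lorentz.mulVec (X.transpose.mulVec n)) := by
      rw [Matrix.mulVec_mulVec, Matrix.mulVec_mulVec, hX]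
    rw [← hnull, ← dotProduct_lorentz, ← dotProduct_lorentz, h1, Matrix.dotProduct_mulVec n,
      ← Matrix.mulVec_transpose]
  · intro h0
    have := congrArg (fun w => X.mulVec w) h0
    simp only [Matrix.mulVec_mulVec, Matrix.mulVec_zero, hXZ, Matrix.one_mulVec] at this
    exact hu this
  · rw [Matrix.dotProduct_mulVec, Matrix.vecMul_transpose, Matrix.mulVec_mulVec, hXZ,
      Matrix.one_mulVec, hun]
  · rw [Matrix.mulVec_mulVec, Matrix.mul_assoc, hXZ, Matrix.mul_one, ← Matrix.mulVec_mulVec, hm,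
      Matrix.mulVec_smul]

end IsLorentzFrame

/-! ### Completion of unit vectors to Lorentz frames -/

theorem exists_frame_of_timelike {x : Fin 3 → ℝ} (hx : lorentzNorm x = 1) :
    ∃ X, IsLorentzFrame X ∧ X 0 = x := by
  rw [lorentzNorm] at hx
  rcases eq_or_ne (x 1 ^ 2 + x 2 ^ 2) 0 with h0 | h0
  · have h1 : x 1 = 0 := by nlinarith [sq_nonneg (x 1), sq_nonneg (x 2)]
    have h2 : x 2 = 0 := by nlinarith [sq_nonneg (x 1), sq_nonneg (x 2)]
    have h3 : x 0 * x 0 = 1 := by rw [h1, h2] at hx; linarith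
    refine ⟨Matrix.of ![x, ![0, 1, 0], ![0, 0, 1]], ?_, rfl⟩
    refine IsLorentzFrame.of_rows hx ?_ ?_ ?_ ?_ ?_ <;> simp [h1, h2]
  · have hpos : 0 < x 1 ^ 2 + x 2 ^ 2 := by positivity
    set ρ := √(x 1 ^ 2 + x 2 ^ 2)
    have hρ : 0 < ρ := Real.sqrt_pos.2 hpos
    have hρ2 : ρ ^ 2 = x 1 ^ 2 + x 2 ^ 2 := Real.sq_sqrt hpos.le
    -- The second row is the normalized spatial part of `x` turned by a right angle. The third
    -- completes the frame in the plane of `x` and the time axis.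
    refine ⟨Matrix.of ![x, ![0, -x 2 / ρ, x 1 / ρ], ![ρ, x 0 * x 1 / ρ, x 0 * x 2 / ρ]], ?_, rfl⟩
    refine IsLorentzFrame.of_rows hx ?_ ?_ ?_ ?_ ?_ <;> simp <;> field_simp
    · linear_combination hρ2
    · linear_combination (ρ ^ 2 + x 1 ^ 2 + x 2 ^ 2 + 1) * hρ2 - (x 1 ^ 2 + x 2 ^ 2) * hx
    · ring
    · linear_combination x 0 * hρ2
    · ring

theorem exists_frame_of_spacelike {x : Fin 3 → ℝ} (hx : lorentzNorm x = -1) :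
    ∃ X, IsLorentzFrame X ∧ X 2 = x := by
  rw [lorentzNorm] at hx
  have hpos : 0 < 1 + x 0 ^ 2 := by positivity
  set ρ := √(1 + x 0 ^ 2)
  have hρ : 0 < ρ := Real.sqrt_pos.2 hpos
  have hρ2 : ρ ^ 2 = 1 + x 0 ^ 2 := Real.sq_sqrt hpos.le
  refine ⟨Matrix.of ![![ρ, x 0 * x 1 / ρ, x 0 * x 2 / ρ], ![0, -x 2 / ρ, x 1 / ρ], x], ?_, rfl⟩
  refine IsLorentzFrame.of_rows ?_ ?_ hx ?_ ?_ ?_ <;> simp <;> field_simp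
  · linear_combination (ρ ^ 2 + x 0 ^ 2) * hρ2 + x 0 ^ 2 * hx
  · linear_combination hρ2 + hx
  · ring
  · linear_combination x 0 * (hρ2 + hx)
  · ring

/-- The determinant of `m` on the annihilator of the null line of `(1, cos θ, sin θ)`. -/
noncomputable def nullDet (m : Matrix (Fin 3) (Fin 3) ℝ) (C S : ℝ) : ℝ :=
  dotProduct ![-1, C, S] (m.mulVec ![-1, C, S]) * dotProduct ![0, -S, C] (m.mulVec ![0, -S, C]) -
    dotProduct ![-1, C, S] (m.mulVec ![0, -S, C]) * dotProduct ![0, -S, C] (m.mulVec ![-1, C, S])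

theorem exists_pair_of_det_eq_zero {a b c d : ℝ} (h : a * d - b * c = 0) :
    ∃ s t : ℝ, (s ≠ 0 ∨ t ≠ 0) ∧ s * a + t * b = 0 ∧ s * c + t * d = 0 := by
  by_cases h0 : a = 0 ∧ b = 0
  · obtain ⟨rfl, rfl⟩ := h0
    by_cases h1 : c = 0 ∧ d = 0
    · obtain ⟨rfl, rfl⟩ := h1
      exact ⟨1, 0, by simp⟩
    · refine ⟨d, -c, ?_, by ring, by ring⟩
      by_contra! h2
      exact h1 ⟨by simpa using h2.2, h2.1⟩
  · refine ⟨b, -a, ?_, by ring, by linarith⟩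
    by_contra! h2
    exact h0 ⟨by simpa using h2.2, h2.1⟩

/-- A kernel vector of the Gram matrix gives `u` in the annihilator with `m u` orthogonal to the
whole annihilator, hence on the null line itself. -/
theorem IsNullNondegenerate.nullDet_ne_zero {m : Matrix (Fin 3) (Fin 3) ℝ}
    (h : IsNullNondegenerate m) {C S : ℝ} (hCS : C ^ 2 + S ^ 2 = 1) : nullDet m C S ≠ 0 := by
  intro h0
  set f : Fin 3 → ℝ := ![-1, C, S] with hf
  set e : Fin 3 → ℝ := ![0, -S, C] with he
  obtain ⟨s, t, hst, h1, h2⟩ := exists_pair_of_det_eq_zero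
    (a := dotProduct f (m.mulVec f)) (b := dotProduct f (m.mulVec e))
    (c := dotProduct e (m.mulVec f)) (d := dotProduct e (m.mulVec e))
    (by rw [nullDet] at h0; linarith)
  set w := m.mulVec (s • f + t • e) with hw
  have hw1 : dotProduct f w = 0 := by
    rw [hw, Matrix.mulVec_add, Matrix.mulVec_smul, Matrix.mulVec_smul, dotProduct_add,
      dotProduct_smul, dotProduct_smul]
    exact h1
  have hw2 : dotProduct e w = 0 := by
    rw [hw, Matrix.mulVec_add, Matrix.mulVec_smul, Matrix.mulVec_smul, dotProduct_add,
      dotProduct_smul, dotProduct_smul]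
    exact h2
  simp [hf, he, dotProduct, Fin.sum_univ_three] at hw1 hw2
  refine h ![1, C, S] (s • f + t • e) (w 0) ?_ ?_ ?_ ?_ ?_
  · intro h'
    simpa using congrFun h' 0
  · simp [lorentzNorm]; linarith
  · intro h'
    have k0 : s = 0 := by simpa [hf, he] using congrFun h' 0
    have k1 : t * S = 0 := by simpa [hf, he, k0] using congrFun h' 1
    have k2 : t * C = 0 := by simpa [hf, he, k0] using congrFun h' 2
    have k3 : t = 0 := by linear_combination C * k2 + S * k1 - t * hCS
    simp [k0, k3] at hst
  · simp [hf, he, dotProduct, Fin.sum_univ_three]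
    linear_combination s * hCS
  · rw [← hw]
    ext i
    fin_cases i
    · simp
    · simp
      linear_combination C * hw1 - S * hw2 - w 1 * hCS
    · simp
      linear_combination S * hw1 + C * hw2 - w 2 * hCS

/-- The determinant is continuous on the circle of null lines and has no zero there, so it keeps its
sign. -/
theorem IsNullNondegenerate.nullDet_mul_pos {m : Matrix (Fin 3) (Fin 3) ℝ}
    (h : IsNullNondegenerate m) (θ φ : ℝ) :
    0 < nullDet m (Real.cos θ) (Real.sin θ) * nullDet m (Real.cos φ) (Real.sin φ) := by
  set F : ℝ → ℝ := fun θ => nullDet m (Real.cos θ) (Real.sin θ) with hF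
  have hne : ∀ θ, F θ ≠ 0 := fun θ => h.nullDet_ne_zero (Real.cos_sq_add_sin_sq θ)
  have hcont : Continuous F := by
    simp only [hF, nullDet, dotProduct, Matrix.mulVec, Fin.sum_univ_three]
    simp
    fun_prop
  by_contra! hle
  have hmem : (0 : ℝ) ∈ Set.uIcc (F θ) (F φ) := by
    rw [Set.mem_uIcc]
    rcases le_total 0 (F θ) with h1 | h1 <;> rcases le_total 0 (F φ) with h2 | h2
    · rcases eq_or_lt_of_le (mul_nonneg h1 h2) with h3 | h3
      · exact absurd h3.symm (mul_ne_zero (hne θ) (hne φ))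
      · exact absurd hle (not_le.2 h3)
    · exact Or.inr ⟨h2, h1⟩
    · exact Or.inl ⟨h1, h2⟩
    · rcases eq_or_lt_of_le (mul_nonneg_of_nonpos_of_nonpos h1 h2) with h3 | h3
      · exact absurd h3.symm (mul_ne_zero (hne θ) (hne φ))
      · exact absurd hle (not_le.2 h3)
  obtain ⟨ψ, -, hψ⟩ := intermediate_value_uIcc hcont.continuousOn hmem
  exact hne ψ hψ

/-! ### Diagonalization by rotations and boosts -/

theorem exists_half_angle {x y : ℝ} (h : x ^ 2 + y ^ 2 = 1) :
    ∃ C S : ℝ, C ^ 2 + S ^ 2 = 1 ∧ C ^ 2 - S ^ 2 = x ∧ 2 * C * S = y := by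
  rcases eq_or_ne x (-1) with rfl | hx
  · exact ⟨0, 1, by norm_num, by norm_num, by nlinarith⟩
  · have hx1 : 0 < (1 + x) / 2 := by
      have : -1 < x := lt_of_le_of_ne (by nlinarith [sq_nonneg y]) hx.symm
      linarith
    set C := √((1 + x) / 2)
    have hC : 0 < C := Real.sqrt_pos.2 hx1
    have hC2 : C ^ 2 = (1 + x) / 2 := Real.sq_sqrt hx1.le
    have hS2 : (y / (2 * C)) ^ 2 = (1 - x) / 2 := by
      rw [div_pow, mul_pow, hC2, div_eq_iff (by linarith)]
      linarith
    exact ⟨C, y / (2 * C), by rw [hC2, hS2]; ring, by rw [hC2, hS2]; ring, by field_simp⟩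

theorem exists_half_rapidity {x y : ℝ} (hx : 0 < x) (h : x ^ 2 - y ^ 2 = 1) :
    ∃ C S : ℝ, C ^ 2 - S ^ 2 = 1 ∧ C ^ 2 + S ^ 2 = x ∧ 2 * C * S = y := by
  have hx1 : 0 < (1 + x) / 2 := by linarith
  set C := √((1 + x) / 2)
  have hC : 0 < C := Real.sqrt_pos.2 hx1
  have hC2 : C ^ 2 = (1 + x) / 2 := Real.sq_sqrt hx1.le
  have hS2 : (y / (2 * C)) ^ 2 = (x - 1) / 2 := by
    rw [div_pow, mul_pow, hC2, div_eq_iff (by linarith)]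
    linarith
  exact ⟨C, y / (2 * C), by rw [hC2, hS2]; ring, by rw [hC2, hS2]; ring, by field_simp⟩

/-- `m` is diagonal in an orthonormal frame of the Lorentz form. -/
def IsLorentzDiagonalizable (m : Matrix (Fin 3) (Fin 3) ℝ) : Prop :=
  ∃ X κ, IsLorentzFrame X ∧ m = X.transpose * Matrix.diagonal κ * X

theorem IsLorentzDiagonalizable.congr {X m : Matrix (Fin 3) (Fin 3) ℝ} (hX : IsLorentzFrame X)
    (hm : IsLorentzDiagonalizable m) : IsLorentzDiagonalizable (X.transpose * m * X) := by
  obtain ⟨Y, κ, hY, rfl⟩ := hm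
  exact ⟨Y * X, κ, hX.mul hY, by simp only [Matrix.transpose_mul, Matrix.mul_assoc]⟩

theorem isLorentzDiagonalizable_of_timelike_block {l a b c : ℝ} :
    IsLorentzDiagonalizable !![l, 0, 0; 0, a, b; 0, b, c] := by
  rcases eq_or_ne ((a - c) ^ 2 + (2 * b) ^ 2) 0 with h0 | h0
  · have h1 : b = 0 := by nlinarith [sq_nonneg (a - c), sq_nonneg b]
    subst h1
    refine ⟨1, ![l, a, c], IsLorentzFrame.one, ?_⟩
    ext i j
    fin_cases i <;> fin_cases j <;> simp
  · have hpos : 0 < (a - c) ^ 2 + (2 * b) ^ 2 := by positivity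
    set ρ := √((a - c) ^ 2 + (2 * b) ^ 2)
    have hρ : 0 < ρ := Real.sqrt_pos.2 hpos
    have hρ2 : ρ ^ 2 = (a - c) ^ 2 + (2 * b) ^ 2 := Real.sq_sqrt hpos.le
    -- Twice the rotation angle is the argument of `(a - c, 2b)`, and `ρ` is the difference of the
    -- two diagonal entries obtained.
    obtain ⟨C, S, h1, h2, h3⟩ := exists_half_angle (x := (a - c) / ρ) (y := 2 * b / ρ)
      (by field_simp; linarith)
    have h2' : (C ^ 2 - S ^ 2) * ρ = a - c := by rw [h2]; field_simp
    have h3' : C * S * ρ = b := by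
      have : 2 * C * S * ρ = 2 * b := by rw [h3]; field_simp
      linarith
    refine ⟨!![1, 0, 0; 0, C, S; 0, -S, C], ![l, (a + c + ρ) / 2, (a + c - ρ) / 2], ?_, ?_⟩
    · apply IsLorentzFrame.of_rows <;> simp <;> linarith
    · ext i j
      fin_cases i <;> fin_cases j <;>
        simp [Matrix.mul_apply, Fin.sum_univ_three]
      · linear_combination (-(a + c) / 2) * h1 - h2' / 2
      · linear_combination -h3'
      · linear_combination -h3'
      · linear_combination (-(a + c) / 2) * h1 + h2' / 2

theorem isLorentzDiagonalizable_of_spacelike_block {l p q r : ℝ}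
    (h : 0 < (p + r) ^ 2 - (2 * q) ^ 2) :
    IsLorentzDiagonalizable !![p, q, 0; q, r, 0; 0, 0, l] := by
  set ρ := √((p + r) ^ 2 - (2 * q) ^ 2)
  have hρ : 0 < ρ := Real.sqrt_pos.2 h
  have hρ2 : ρ ^ 2 = (p + r) ^ 2 - (2 * q) ^ 2 := Real.sq_sqrt h.le
  -- A boost needs a positive hyperbolic cosine, so `σ` takes the sign of `p + r`.
  obtain ⟨σ, hσ, hσpos⟩ : ∃ σ : ℝ, σ ^ 2 = ρ ^ 2 ∧ 0 < (p + r) / σ := by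
    rcases lt_trichotomy (p + r) 0 with h1 | h1 | h1
    · exact ⟨-ρ, by ring, div_pos_of_neg_of_neg h1 (by linarith)⟩
    · rw [h1] at h
      nlinarith [sq_nonneg q]
    · exact ⟨ρ, rfl, div_pos h1 hρ⟩
  have hσ0 : σ ≠ 0 := by rintro rfl; simp at hσpos
  obtain ⟨C, S, h1, h2, h3⟩ := exists_half_rapidity (x := (p + r) / σ) (y := 2 * q / σ) hσpos
    (by field_simp; linarith)
  have h2' : (C ^ 2 + S ^ 2) * σ = p + r := by rw [h2]; field_simp
  have h3' : C * S * σ = q := by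
    have : 2 * C * S * σ = 2 * q := by rw [h3]; field_simp
    linarith
  refine ⟨!![C, S, 0; S, C, 0; 0, 0, 1], ![(σ + (p - r)) / 2, (σ - (p - r)) / 2, l], ?_, ?_⟩
  · apply IsLorentzFrame.of_rows <;> simp <;> linarith
  · ext i j
    fin_cases i <;> fin_cases j <;>
      simp [Matrix.mul_apply, Fin.sum_univ_three]
    · linear_combination (-(p - r) / 2) * h1 - h2' / 2
    · linear_combination -h3'
    · linear_combination -h3'
    · linear_combination ((p - r) / 2) * h1 - h2' / 2

theorem exists_root_cubic (a b c : ℝ) : ∃ t : ℝ, t ^ 3 + a * t ^ 2 + b * t + c = 0 := by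
  set R := 1 + |a| + |b| + |c| with hR
  have ha := abs_nonneg a
  have hb := abs_nonneg b
  have hc := abs_nonneg c
  have hR1 : 1 ≤ R := by linarith
  have hR2 : R ≤ R ^ 2 := by nlinarith
  have hcont : Continuous fun t : ℝ => t ^ 3 + a * t ^ 2 + b * t + c := by fun_prop
  have e1 : |a| * R ^ 2 + |b| * R + |c| ≤ (R - 1) * R ^ 2 := by
    have h1 : |b| * R ≤ |b| * R ^ 2 := mul_le_mul_of_nonneg_left hR2 hb
    have h2 : |c| * 1 ≤ |c| * R ^ 2 := mul_le_mul_of_nonneg_left (by linarith) hc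
    have h3 : R - 1 = |a| + |b| + |c| := by rw [hR]; ring
    rw [h3]
    linarith
  have hpos : 0 ≤ R ^ 3 + a * R ^ 2 + b * R + c := by
    have h1 : -|a| * R ^ 2 ≤ a * R ^ 2 := mul_le_mul_of_nonneg_right (neg_abs_le a) (sq_nonneg R)
    have h2 : -|b| * R ≤ b * R := mul_le_mul_of_nonneg_right (neg_abs_le b) (by linarith)
    have h3 := neg_abs_le c
    nlinarith [sq_nonneg R]
  have hneg : (-R) ^ 3 + a * (-R) ^ 2 + b * (-R) + c ≤ 0 := by
    have h1 : a * R ^ 2 ≤ |a| * R ^ 2 := mul_le_mul_of_nonneg_right (le_abs_self a) (sq_nonneg R)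
    have h2 : -|b| * R ≤ b * R := mul_le_mul_of_nonneg_right (neg_abs_le b) (by linarith)
    have h3 := le_abs_self c
    nlinarith [sq_nonneg R]
  obtain ⟨t, -, ht⟩ := intermediate_value_Icc (show -R ≤ R by linarith) hcont.continuousOn
    (show (0 : ℝ) ∈ Set.Icc _ _ from ⟨hneg, hpos⟩)
  exact ⟨t, ht⟩

theorem exists_lorentz_eigenvector (m : Matrix (Fin 3) (Fin 3) ℝ) :
    ∃ (l : ℝ) (x : Fin 3 → ℝ), x ≠ 0 ∧ m.mulVec (lorentz.mulVec x) = l • x := by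
  set A := m * lorentz with hA
  obtain ⟨l, hl⟩ : ∃ l : ℝ, (Matrix.diagonal (fun _ => l) - A).det = 0 := by
    obtain ⟨t, ht⟩ := exists_root_cubic (-(A 0 0 + A 1 1 + A 2 2))
      (A 0 0 * A 1 1 + A 0 0 * A 2 2 + A 1 1 * A 2 2 - A 0 1 * A 1 0 - A 0 2 * A 2 0 -
        A 1 2 * A 2 1) (-A.det)
    refine ⟨t, ?_⟩
    rw [Matrix.det_fin_three] at ht ⊢
    simp only [Matrix.sub_apply, Matrix.diagonal_apply]
    simp
    linear_combination ht
  obtain ⟨x, hx, h⟩ := Matrix.exists_mulVec_eq_zero_iff.2 hl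
  refine ⟨l, x, hx, ?_⟩
  rw [Matrix.mulVec_mulVec, ← hA]
  rw [Matrix.sub_mulVec, sub_eq_zero] at h
  rw [← h]
  ext i
  simp [Matrix.mulVec_diagonal]

theorem IsLorentzFrame.mulVec_single {X m : Matrix (Fin 3) (Fin 3) ℝ} (hX : IsLorentzFrame X)
    {i : Fin 3} {l : ℝ}
    (h : (X.transpose * m * X).mulVec (lorentz.mulVec (X i)) = l • X i) :
    m.mulVec (lorentz.mulVec (Pi.single i 1)) = l • Pi.single i 1 := by
  have hXi : X i = X.transpose.mulVec (Pi.single i 1) := by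
    rw [Matrix.mulVec_single_one]
    rfl
  have hinj : ∀ a c : Fin 3 → ℝ, X.transpose.mulVec a = X.transpose.mulVec c → a = c := by
    intro a c hac
    have h1 := mul_eq_one_comm.1 hX.transpose_mul
    have := congrArg (fun w => (lorentz * X * lorentz).mulVec w) hac
    simpa only [Matrix.mulVec_mulVec, h1, Matrix.one_mulVec] using this
  apply hinj
  rw [Matrix.mulVec_smul, ← hXi, ← h, hXi]
  simp only [Matrix.mulVec_mulVec, Matrix.mul_assoc]
  rw [← Matrix.mul_assoc X, hX]

/-- The cubic characteristic polynomial of `m * lorentz` supplies a real eigenvector. It is not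
null, as its dual covector would contradict non-degeneracy. A timelike eigenvector leaves a definite
complement, where a rotation suffices; a spacelike one leaves a Lorentzian plane, where the constant
sign of `nullDet` supplies the inequality needed for a boost. -/
theorem IsNullNondegenerate.isLorentzDiagonalizable {m : Matrix (Fin 3) (Fin 3) ℝ}
    (hm : m.IsSymm) (h : IsNullNondegenerate m) : IsLorentzDiagonalizable m := by
  obtain ⟨l, x, hx0, hx⟩ := exists_lorentz_eigenvector m
  have hN : lorentzNorm x ≠ 0 := by
    intro h0
    refine h x (lorentz.mulVec x) l hx0 h0 ?_ ?_ hx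
    · intro h1
      apply hx0
      have := congrArg (fun w => lorentz.mulVec w) h1
      simpa only [Matrix.mulVec_mulVec, lorentz_mul_self, Matrix.one_mulVec,
        Matrix.mulVec_zero] using this
    · rw [dotProduct_comm, dotProduct_lorentz, h0]
  have hnorm : ∀ t : ℝ, lorentzNorm (t • x) = t ^ 2 * lorentzNorm x := fun t => by
    simp [lorentzNorm]
    ring
  have hsmul : ∀ t : ℝ, m.mulVec (lorentz.mulVec (t • x)) = l • (t • x) := fun t => by
    rw [Matrix.mulVec_smul, Matrix.mulVec_smul, hx, smul_comm]
  rcases lt_or_gt_of_ne hN with hneg | hpos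
  · obtain ⟨X, hX, hXx⟩ := exists_frame_of_spacelike (x := (√(-lorentzNorm x))⁻¹ • x) (by
      rw [hnorm, inv_pow, Real.sq_sqrt (by linarith)]
      field_simp)
    obtain ⟨m', hm', rfl⟩ := hX.exists_eq m hm
    have key := hX.mulVec_single (i := 2) (m := m') (l := l) (by rw [hXx, hsmul])
    have k0 : m' 0 2 = 0 := by
      simpa [lorentz, Matrix.mulVec, dotProduct, Fin.sum_univ_three] using congrFun key 0
    have k1 : m' 1 2 = 0 := by
      simpa [lorentz, Matrix.mulVec, dotProduct, Fin.sum_univ_three] using congrFun key 1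
    have hnd := hX.isNullNondegenerate h
    have s01 : m' 1 0 = m' 0 1 := hm'.apply 0 1
    have s02 : m' 2 0 = 0 := (hm'.apply 0 2).trans k0
    have s12 : m' 2 1 = 0 := (hm'.apply 1 2).trans k1
    have hform : m' = !![m' 0 0, m' 0 1, 0; m' 0 1, m' 1 1, 0; 0, 0, m' 2 2] := by
      ext i j
      fin_cases i <;> fin_cases j <;> simp [k0, k1, s01, s02, s12]
    refine IsLorentzDiagonalizable.congr hX ?_
    rw [hform]
    refine isLorentzDiagonalizable_of_spacelike_block ?_
    -- The null lines at angles `0` and `π` are those of the complementary plane; the two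
    -- determinants are `l(p + r ∓ 2q)` in the notation of the block lemma.
    have hp := hnd.nullDet_mul_pos 0 Real.pi
    simp [nullDet, Matrix.mulVec, dotProduct, Fin.sum_univ_three, k0, k1, s01, s02, s12] at hp
    by_contra! hle
    have h1 : m' 2 2 ^ 2 * ((m' 0 0 + m' 1 1) ^ 2 - (2 * m' 0 1) ^ 2) ≤ 0 :=
      mul_nonpos_of_nonneg_of_nonpos (sq_nonneg _) hle
    nlinarith
  · obtain ⟨X, hX, hXx⟩ := exists_frame_of_timelike (x := (√(lorentzNorm x))⁻¹ • x) (by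
      rw [hnorm, inv_pow, Real.sq_sqrt (by linarith)]
      field_simp)
    obtain ⟨m', hm', rfl⟩ := hX.exists_eq m hm
    have key := hX.mulVec_single (i := 0) (m := m') (l := l) (by rw [hXx, hsmul])
    have k1 : m' 1 0 = 0 := by
      simpa [lorentz, Matrix.mulVec, dotProduct, Fin.sum_univ_three] using congrFun key 1
    have k2 : m' 2 0 = 0 := by
      simpa [lorentz, Matrix.mulVec, dotProduct, Fin.sum_univ_three] using congrFun key 2
    have s01 : m' 0 1 = 0 := (hm'.apply 1 0).trans k1
    have s02 : m' 0 2 = 0 := (hm'.apply 2 0).trans k2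
    have s12 : m' 2 1 = m' 1 2 := hm'.apply 1 2
    have hform : m' = !![m' 0 0, 0, 0; 0, m' 1 1, m' 1 2; 0, m' 1 2, m' 2 2] := by
      ext i j
      fin_cases i <;> fin_cases j <;> simp [k1, k2, s01, s02, s12]
    refine IsLorentzDiagonalizable.congr hX ?_
    rw [hform]
    exact isLorentzDiagonalizable_of_timelike_block

/-- The sign condition on the eigenvalues of a null-nondegenerate matrix. -/
theorem IsNullNondegenerate.diagonal_pos {κ : Fin 3 → ℝ}
    (h : IsNullNondegenerate (Matrix.diagonal κ)) :
    0 < κ 1 * κ 2 * (κ 1 + κ 0) * (κ 2 + κ 0) := by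
  have hp := h.nullDet_mul_pos 0 (Real.pi / 2)
  simp [nullDet, dotProduct, Fin.sum_univ_three, Matrix.mulVec_diagonal] at hp
  linarith

/-- If the determinants of `m` on the annihilators of all null lines vanish, then `m` is a multiple
of the Lorentz form or a multiple of a square. -/
theorem eq_smul_lorentz_or_eq_square {m : Matrix (Fin 3) (Fin 3) ℝ} (hm : m.IsSymm)
    (h : ∀ C S : ℝ, C ^ 2 + S ^ 2 = 1 → nullDet m C S = 0) :
    (∃ c : ℝ, m = c • lorentz) ∨
      ∃ (σ : ℝ) (l : Fin 3 → ℝ), m = Matrix.of fun i j => σ * (l i * l j) := by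
  have s10 : m 1 0 = m 0 1 := hm.apply 0 1
  have s20 : m 2 0 = m 0 2 := hm.apply 0 2
  have s21 : m 2 1 = m 1 2 := hm.apply 1 2
  -- `nullDet m C S` is the adjugate of `m` evaluated at `(1, C, S)`. Vanishing at five points of
  -- this conic makes the adjugate a multiple `k` of the Lorentz form.
  have h1 := h 1 0 (by norm_num)
  have h2 := h (-1) 0 (by norm_num)
  have h3 := h 0 1 (by norm_num)
  have h4 := h 0 (-1) (by norm_num)
  have h5 := h (3 / 5) (4 / 5) (by norm_num)
  simp [nullDet, Matrix.mulVec, dotProduct, Fin.sum_univ_three, s10, s20, s21] at h1 h2 h3 h4 h5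
  set a := m 0 0
  set b := m 0 1
  set c := m 0 2
  set d := m 1 1
  set e := m 1 2
  set f := m 2 2
  have e01 : c * e - b * f = 0 := by linarith
  have e02 : b * e - c * d = 0 := by linarith
  have e11 : a * f - c ^ 2 = -(d * f - e ^ 2) := by linarith
  have e22 : a * d - b ^ 2 = -(d * f - e ^ 2) := by linarith
  have e12 : b * c - a * e = 0 := by linarith
  set k := d * f - e ^ 2 with hk
  have hform : m = !![a, b, c; b, d, e; c, e, f] := by
    ext i j
    fin_cases i <;> fin_cases j <;> simp [a, b, c, d, e, f, s10, s20, s21]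
  -- Off-diagonal entries of `m * adj m = det m • 1`, with `adj m = k • lorentz`.
  have hb : k * b = 0 := by linear_combination b * e11 + a * e01 + c * e12
  have hc : k * c = 0 := by linear_combination c * e22 + a * e02 + b * e12
  have he : k * e = 0 := by linear_combination e * e22 + b * e02 + d * e12
  clear_value a b c d e f k
  -- For `k = 0` all two-by-two minors vanish, so `m` has rank at most one and is a multiple of the
  -- square of any row with non-zero diagonal entry.
  rcases eq_or_ne k 0 with rfl | hk0
  · by_cases ha : a = 0
    · by_cases hd : d = 0
      · by_cases hf : f = 0
        · subst ha hd hf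
          have hb : b = 0 := by nlinarith
          have hc : c = 0 := by nlinarith
          have he : e = 0 := by nlinarith
          subst hb hc he
          left
          refine ⟨0, ?_⟩
          rw [hform]
          ext i j
          fin_cases i <;> fin_cases j <;> simp
        · right
          refine ⟨f⁻¹, ![c, e, f], ?_⟩
          rw [hform]
          ext i j
          fin_cases i <;> fin_cases j <;> simp <;> field_simp <;> linarith
      · right
        refine ⟨d⁻¹, ![b, d, e], ?_⟩
        rw [hform]
        ext i j
        fin_cases i <;> fin_cases j <;> simp <;> field_simp <;> linarith
    · right
      refine ⟨a⁻¹, ![a, b, c], ?_⟩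
      rw [hform]
      ext i j
      fin_cases i <;> fin_cases j <;> simp <;> field_simp <;> linarith
  · have hb : b = 0 := by simpa [hk0] using hb
    have hc : c = 0 := by simpa [hk0] using hc
    have he : e = 0 := by simpa [hk0] using he
    subst hb hc he
    have hf : f ≠ 0 := by rintro rfl; simp at hk; exact hk0 hk
    have hd : d ≠ 0 := by rintro rfl; simp at hk; exact hk0 hk
    have h1 : a = -d := mul_right_cancel₀ hf (by linarith)
    have h2 : a = -f := mul_right_cancel₀ hd (by linarith)
    left
    refine ⟨a, ?_⟩
    rw [hform]
    ext i j
    fin_cases i <;> fin_cases j <;> simp [lorentz] <;> linarith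

/-! ### Algebraic curvature tensors -/

namespace IsAlgebraicCurvatureTensor

variable {A B : Tensor4 V}

theorem skew_right (hA : IsAlgebraicCurvatureTensor A) (x y z v : V) :
    A x y z v = -A x y v z := by
  rw [hA.pair, hA.skew, hA.pair]

theorem self_left (hA : IsAlgebraicCurvatureTensor A) (x z v : V) : A x x z v = 0 := by
  have := hA.skew x x z v
  linarith

theorem self_right (hA : IsAlgebraicCurvatureTensor A) (x y z : V) : A x y z z = 0 := by
  have := hA.skew_right x y z z
  linarith

theorem smul (hA : IsAlgebraicCurvatureTensor A) (t : ℝ) :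
    IsAlgebraicCurvatureTensor (t • A) where
  skew x y z v := by
    simp only [LinearMap.smul_apply, smul_eq_mul, hA.skew x y z v]
    ring
  pair x y z v := by
    simp only [LinearMap.smul_apply, smul_eq_mul, hA.pair x y z v]
  bianchi x y z v := by
    have h1 := hA.bianchi x y z v
    simp only [LinearMap.smul_apply, smul_eq_mul]
    linear_combination t * h1

/-- The value on a plane depends on the spanning vectors through their determinant only. -/
theorem apply_plane (hA : IsAlgebraicCurvatureTensor A) (x y : V) (p q r t : ℝ) :
    A (p • x + q • y) (r • x + t • y) (p • x + q • y) (r • x + t • y) =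
      (p * t - q * r) ^ 2 * A x y x y := by
  have h1 := hA.skew y x y x
  have h2 := hA.skew_right x y y x
  have h3 := hA.skew y x x y
  simp only [map_add, map_smul, LinearMap.add_apply, LinearMap.smul_apply, smul_eq_mul,
    hA.self_left, hA.self_right, h1, h2, h3]
  ring

/-- Algebraic curvature tensors on a four-dimensional space are determined by twenty components. -/
theorem ext_of_basis (hA : IsAlgebraicCurvatureTensor A) (hB : IsAlgebraicCurvatureTensor B)
    (b : Basis (Fin 4) ℝ V)
    (h0101 : A (b 0) (b 1) (b 0) (b 1) = B (b 0) (b 1) (b 0) (b 1))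
    (h0102 : A (b 0) (b 1) (b 0) (b 2) = B (b 0) (b 1) (b 0) (b 2))
    (h0103 : A (b 0) (b 1) (b 0) (b 3) = B (b 0) (b 1) (b 0) (b 3))
    (h0112 : A (b 0) (b 1) (b 1) (b 2) = B (b 0) (b 1) (b 1) (b 2))
    (h0113 : A (b 0) (b 1) (b 1) (b 3) = B (b 0) (b 1) (b 1) (b 3))
    (h0123 : A (b 0) (b 1) (b 2) (b 3) = B (b 0) (b 1) (b 2) (b 3))
    (h0202 : A (b 0) (b 2) (b 0) (b 2) = B (b 0) (b 2) (b 0) (b 2))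
    (h0203 : A (b 0) (b 2) (b 0) (b 3) = B (b 0) (b 2) (b 0) (b 3))
    (h0212 : A (b 0) (b 2) (b 1) (b 2) = B (b 0) (b 2) (b 1) (b 2))
    (h0213 : A (b 0) (b 2) (b 1) (b 3) = B (b 0) (b 2) (b 1) (b 3))
    (h0223 : A (b 0) (b 2) (b 2) (b 3) = B (b 0) (b 2) (b 2) (b 3))
    (h0303 : A (b 0) (b 3) (b 0) (b 3) = B (b 0) (b 3) (b 0) (b 3))
    (h0313 : A (b 0) (b 3) (b 1) (b 3) = B (b 0) (b 3) (b 1) (b 3))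
    (h0323 : A (b 0) (b 3) (b 2) (b 3) = B (b 0) (b 3) (b 2) (b 3))
    (h1212 : A (b 1) (b 2) (b 1) (b 2) = B (b 1) (b 2) (b 1) (b 2))
    (h1213 : A (b 1) (b 2) (b 1) (b 3) = B (b 1) (b 2) (b 1) (b 3))
    (h1223 : A (b 1) (b 2) (b 2) (b 3) = B (b 1) (b 2) (b 2) (b 3))
    (h1313 : A (b 1) (b 3) (b 1) (b 3) = B (b 1) (b 3) (b 1) (b 3))
    (h1323 : A (b 1) (b 3) (b 2) (b 3) = B (b 1) (b 3) (b 2) (b 3))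
    (h2323 : A (b 2) (b 3) (b 2) (b 3) = B (b 2) (b 3) (b 2) (b 3)) : A = B := by
  -- There are 21 unordered pairs of index pairs; the Bianchi identity eliminates this one.
  have h0312 : A (b 0) (b 3) (b 1) (b 2) = B (b 0) (b 3) (b 1) (b 2) := by
    have e1 := hA.bianchi (b 0) (b 1) (b 2) (b 3)
    have e2 := hA.skew (b 2) (b 0) (b 1) (b 3)
    have e3 := hA.pair (b 1) (b 2) (b 0) (b 3)
    have f1 := hB.bianchi (b 0) (b 1) (b 2) (b 3)
    have f2 := hB.skew (b 2) (b 0) (b 1) (b 3)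
    have f3 := hB.pair (b 1) (b 2) (b 0) (b 3)
    linarith
  have key : ∀ i j k l, i < j → k < l → A (b i) (b j) (b k) (b l) = B (b i) (b j) (b k) (b l) := by
    intro i j k l hij hkl
    fin_cases i <;> fin_cases j <;> first | exact absurd hij (by decide) | skip
    all_goals fin_cases k <;> fin_cases l <;> first | exact absurd hkl (by decide) | skip
    all_goals first | assumption | (rw [hA.pair, hB.pair]; assumption)
  have key2 : ∀ i j k l, i < j → A (b i) (b j) (b k) (b l) = B (b i) (b j) (b k) (b l) := by
    intro i j k l hij
    rcases lt_trichotomy k l with h | rfl | h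
    · exact key i j k l hij h
    · rw [hA.self_right, hB.self_right]
    · rw [hA.skew_right, key i j l k hij h, ← hB.skew_right]
  refine b.ext fun i => b.ext fun j => b.ext fun k => b.ext fun l => ?_
  rcases lt_trichotomy i j with h | rfl | h
  · exact key2 i j k l h
  · rw [hA.self_left, hB.self_left]
  · rw [hA.skew, key2 j i k l h, ← hB.skew]

end IsAlgebraicCurvatureTensor

theorem isAlgebraicCurvatureTensor_constCurv {g : LinearMap.BilinForm ℝ V} (hg : g.IsSymm) :
    IsAlgebraicCurvatureTensor (constCurv g) where
  skew x y z v := by simp only [constCurv_apply]; ring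
  pair x y z v := by
    simp only [constCurv_apply, hg.eq v x, hg.eq z y, hg.eq z x, hg.eq v y]
    ring
  bianchi x y z v := by
    simp only [constCurv_apply, hg.eq z x, hg.eq y x, hg.eq z y]
    ring

/-- The unsymmetrized polarization of `Ψ ↦ A^Ψ`. -/
noncomputable def polarCurv (g : LinearMap.BilinForm ℝ V) (Ψ Φ : V →ₗ[ℝ] V) : Tensor4 V :=
  LinearMap.mk₂ ℝ
    (fun x y => LinearMap.mk₂ ℝ
      (fun z v => g (Ψ y) z * g (Φ x) v - g (Ψ x) z * g (Φ y) v - 2 * g (Ψ x) y * g (Φ z) v)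
      (by intros; simp; ring) (by intros; simp; ring)
      (by intros; simp; ring) (by intros; simp; ring))
    (by intros; ext; simp; ring) (by intros; ext; simp; ring)
    (by intros; ext; simp; ring) (by intros; ext; simp; ring)

/-- The curvature tensor `∑ mᵢⱼ A^{Ψᵢ, Ψⱼ}`. -/
noncomputable def quadCurv (g : LinearMap.BilinForm ℝ V) (m : Matrix (Fin 3) (Fin 3) ℝ)
    (Ψ : Fin 3 → V →ₗ[ℝ] V) : Tensor4 V :=
  ∑ i, ∑ j, m i j • polarCurv g (Ψ i) (Ψ j)

theorem quadCurv_apply (g : LinearMap.BilinForm ℝ V) (m : Matrix (Fin 3) (Fin 3) ℝ)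
    (Ψ : Fin 3 → V →ₗ[ℝ] V) (x y z v : V) :
    quadCurv g m Ψ x y z v = ∑ i, ∑ j, m i j * (g (Ψ i y) z * g (Ψ j x) v -
      g (Ψ i x) z * g (Ψ j y) v - 2 * g (Ψ i x) y * g (Ψ j z) v) := by
  simp [quadCurv, polarCurv, LinearMap.sum_apply]

theorem isAlgebraicCurvatureTensor_quadCurv {g : LinearMap.BilinForm ℝ V} (hg : g.IsSymm)
    {m : Matrix (Fin 3) (Fin 3) ℝ} (hm : m.IsSymm) {Ψ : Fin 3 → V →ₗ[ℝ] V}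
    (hΨ : ∀ i, g.IsSkewAdjoint (Ψ i)) : IsAlgebraicCurvatureTensor (quadCurv g m Ψ) := by
  have hs : ∀ i x y, g (Ψ i x) y = -g (Ψ i y) x := fun i x y => by
    rw [skewAdjoint_apply (hΨ i), hg.eq]
  have hm' : ∀ i j, m i j = m j i := fun i j => hm.apply j i
  refine ⟨fun x y z v => ?_, fun x y z v => ?_, fun x y z v => ?_⟩
  · rw [quadCurv_apply, quadCurv_apply, ← Finset.sum_neg_distrib]
    refine Finset.sum_congr rfl fun i _ => ?_
    rw [← Finset.sum_neg_distrib]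
    refine Finset.sum_congr rfl fun j _ => ?_
    rw [hs i y x]
    ring
  · simp only [quadCurv_apply, Fin.sum_univ_three, hm' 1 0, hm' 2 0, hm' 2 1, hs _ v x, hs _ z y,
      hs _ z x, hs _ v y]
    ring
  · simp only [quadCurv_apply]
    rw [← Finset.sum_add_distrib, ← Finset.sum_add_distrib]
    refine Finset.sum_eq_zero fun i _ => ?_
    rw [← Finset.sum_add_distrib, ← Finset.sum_add_distrib]
    refine Finset.sum_eq_zero fun j _ => ?_
    rw [hs i z x, hs i z y, hs i y x]
    ring

/-- Diagonalizing the coefficient matrix. -/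
theorem quadCurv_congr_diagonal (g : LinearMap.BilinForm ℝ V) (X : Matrix (Fin 3) (Fin 3) ℝ)
    (κ : Fin 3 → ℝ) (Ψ : Fin 3 → V →ₗ[ℝ] V) :
    quadCurv g (X.transpose * Matrix.diagonal κ * X) Ψ =
      ∑ k, κ k • endoCurv g (∑ i, X k i • Ψ i) := by
  ext x y z v
  set t : Fin 3 → Fin 3 → ℝ := fun i j =>
    g (Ψ i y) z * g (Ψ j x) v - g (Ψ i x) z * g (Ψ j y) v - 2 * g (Ψ i x) y * g (Ψ j z) v with ht
  have hk : ∀ k, endoCurv g (∑ i, X k i • Ψ i) x y z v =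
      ∑ i, ∑ j, X k i * X k j * t i j := fun k => by
    simp only [ht, endoCurv_apply, Fin.sum_univ_three, LinearMap.add_apply, LinearMap.smul_apply,
      map_add, map_smul, smul_eq_mul]
    ring
  have hij : ∀ i j, (X.transpose * Matrix.diagonal κ * X) i j =
      ∑ k, κ k * (X k i * X k j) := fun i j => by
    rw [Matrix.mul_apply]
    refine Finset.sum_congr rfl fun k _ => ?_
    rw [Matrix.mul_diagonal, Matrix.transpose_apply]
    ring
  have hL : quadCurv g (X.transpose * Matrix.diagonal κ * X) Ψ x y z v =
      ∑ i, ∑ j, (∑ k, κ k * (X k i * X k j)) * t i j := by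
    simp only [quadCurv_apply, hij, ht]
  simp only [LinearMap.sum_apply, LinearMap.smul_apply, hk, hL, smul_eq_mul]
  simp only [Fin.sum_univ_three]
  ring

theorem jacobi_quadCurv [FiniteDimensional ℝ V] {M : Model V} {m : Matrix (Fin 3) (Fin 3) ℝ}
    (hm : m.IsSymm) {Ψ : Fin 3 → V →ₗ[ℝ] V} (hΨ : ∀ i, M.form.IsSkewAdjoint (Ψ i))
    (hA : M.curv = quadCurv M.form m Ψ) (v y : V) :
    M.jacobi v y = (3 : ℝ) • ∑ j, (m.mulVec fun i => M.form y (Ψ i v)) j • Ψ j v := by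
  refine M.jacobi_apply_eq fun z => ?_
  have hm' : ∀ i j, m i j = m j i := fun i j => hm.apply j i
  rw [hA, quadCurv_apply, Finset.sum_comm, map_smul, LinearMap.smul_apply, map_sum,
    LinearMap.sum_apply, smul_eq_mul, Finset.mul_sum]
  refine Finset.sum_congr rfl fun j _ => ?_
  rw [map_smul, LinearMap.smul_apply, smul_eq_mul, Matrix.mulVec, dotProduct, Finset.sum_mul,
    Finset.mul_sum]
  refine Finset.sum_congr rfl fun i _ => ?_
  rw [form_skewAdjoint_self M.form_symm (hΨ i), hm' i j, skewAdjoint_apply (hΨ i) y v]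
  ring

/-- An orthonormal change of frame preserves paraquaternionic structures. -/
theorem IsParaquaternionic.congr {g : LinearMap.BilinForm ℝ V} {Ψ : Fin 3 → V →ₗ[ℝ] V}
    (h : IsParaquaternionic g (Ψ 0) (Ψ 1) (Ψ 2)) {X : Matrix (Fin 3) (Fin 3) ℝ}
    (hX : IsLorentzFrame X) :
    IsParaquaternionic g (∑ i, X 0 i • Ψ i) (∑ i, X 1 i • Ψ i) (∑ i, X 2 i • Ψ i) := by
  have hskew : ∀ k, g.IsSkewAdjoint (∑ i, X k i • Ψ i : V →ₗ[ℝ] V) := fun k =>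
    isSkewAdjoint_of_apply fun x y => by
      simp only [Fin.sum_univ_three, LinearMap.add_apply, LinearMap.smul_apply, map_add, map_smul,
        smul_eq_mul, skewAdjoint_apply h.complex₁.1 x, skewAdjoint_apply h.para₂.1 x,
        skewAdjoint_apply h.para₃.1 x]
      ring
  have hX' : ∀ k l, X k 0 * X l 0 - X k 1 * X l 1 - X k 2 * X l 2 = lorentz k l := fun k l => by
    rw [← hX, Matrix.mul_apply, Fin.sum_univ_three, lorentz]
    simp only [Matrix.mul_diagonal, Matrix.transpose_apply]
    simp
    ring
  have hsum : ∀ k l x, (∑ i, X k i • Ψ i) ((∑ i, X l i • Ψ i) x) +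
      (∑ i, X l i • Ψ i) ((∑ i, X k i • Ψ i) x) = (-2 * lorentz k l) • x := fun k l x => by
    rw [← hX']
    simp only [Fin.sum_univ_three, LinearMap.add_apply, LinearMap.smul_apply, map_add, map_smul,
      h.sq₁, h.sq₂, h.sq₃, h.comm₂₁, h.comm₃₁, h.comm₃₂]
    module
  have hhalf : ∀ a c : V, (2 : ℝ) • a = (2 : ℝ) • c → a = c := fun a c hac => by
    simpa using hac
  refine ⟨⟨hskew 0, ?_⟩, ⟨hskew 1, ?_⟩, ⟨hskew 2, ?_⟩, ?_, ?_, ?_⟩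
  · ext x
    have := hsum 0 0 x
    simp only [lorentz, Matrix.diagonal_apply_eq] at this
    apply hhalf
    rw [LinearMap.comp_apply, two_smul, this]
    simp
  · ext x
    have := hsum 1 1 x
    simp only [lorentz, Matrix.diagonal_apply_eq] at this
    apply hhalf
    rw [LinearMap.comp_apply, two_smul, this]
    simp
  · ext x
    have := hsum 2 2 x
    simp only [lorentz, Matrix.diagonal_apply_eq] at this
    apply hhalf
    rw [LinearMap.comp_apply, two_smul, this]
    simp
  · ext x
    rw [LinearMap.add_apply, LinearMap.comp_apply, LinearMap.comp_apply, hsum 0 1 x]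
    simp [lorentz]
  · ext x
    rw [LinearMap.add_apply, LinearMap.comp_apply, LinearMap.comp_apply, hsum 0 2 x]
    simp [lorentz]
  · ext x
    rw [LinearMap.add_apply, LinearMap.comp_apply, LinearMap.comp_apply, hsum 1 2 x]
    simp [lorentz]

/-! ### The standard paraquaternionic structure of a null frame -/

namespace IsNullFrame

variable {g : LinearMap.BilinForm ℝ V} {b : Fin 4 → V}

/-- The paraquaternionic structure acting on the first factor of `V ≅ ℝ² ⊗ ℝ²`. -/
noncomputable def para (h : IsNullFrame g b) (hdim : finrank ℝ V = 4) : Fin 3 → V →ₗ[ℝ] V :=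
  ![(h.basis hdim).constr ℝ ![b 2, b 3, -b 0, -b 1],
    (h.basis hdim).constr ℝ ![b 0, b 1, -b 2, -b 3],
    (h.basis hdim).constr ℝ ![b 2, b 3, b 0, b 1]]

theorem para_apply (h : IsNullFrame g b) (hdim : finrank ℝ V = 4) (i : Fin 3) (k : Fin 4) :
    h.para hdim i (b k) = ![![b 2, b 3, -b 0, -b 1], ![b 0, b 1, -b 2, -b 3],
      ![b 2, b 3, b 0, b 1]] i k := by
  have key : ∀ f : Fin 4 → V, (h.basis hdim).constr ℝ f (b k) = f k := fun f => by
    have := (h.basis hdim).constr_basis ℝ f k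
    rwa [coe_basis] at this
  fin_cases i <;> exact key _

theorem para_isSkewAdjoint (h : IsNullFrame g b) (hdim : finrank ℝ V = 4) (i : Fin 3) :
    g.IsSkewAdjoint (h.para hdim i) := by
  have heq : g ∘ₗ h.para hdim i = -(g.compl₂ (h.para hdim i)) := by
    refine (h.basis hdim).ext fun k => (h.basis hdim).ext fun l => ?_
    simp only [coe_basis, LinearMap.comp_apply, LinearMap.neg_apply, LinearMap.compl₂_apply,
      para_apply]
    fin_cases i <;> fin_cases k <;> fin_cases l <;> simp [h _ _]
  refine isSkewAdjoint_of_apply fun x y => ?_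
  have := LinearMap.congr_fun (LinearMap.congr_fun heq x) y
  simpa using this

theorem para_isParaquaternionic (h : IsNullFrame g b) (hdim : finrank ℝ V = 4) :
    IsParaquaternionic g (h.para hdim 0) (h.para hdim 1) (h.para hdim 2) := by
  refine ⟨⟨h.para_isSkewAdjoint hdim 0, ?_⟩, ⟨h.para_isSkewAdjoint hdim 1, ?_⟩,
    ⟨h.para_isSkewAdjoint hdim 2, ?_⟩, ?_, ?_, ?_⟩ <;>
  · refine h.ext_endo hdim fun k => ?_
    fin_cases k <;> simp [para_apply]

/-- The relation `A^{Ψ₁} - A^{Ψ₂} - A^{Ψ₃} = 3A⁰` is how constant curvature appears among the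
paraquaternionic tensors. -/
theorem quadCurv_lorentz (h : IsNullFrame g b) (hg : g.IsSymm) (hdim : finrank ℝ V = 4) :
    quadCurv g lorentz (h.para hdim) = (3 : ℝ) • constCurv g := by
  refine (isAlgebraicCurvatureTensor_quadCurv hg (by simp [Matrix.IsSymm, lorentz])
    (h.para_isSkewAdjoint hdim)).ext_of_basis
    ((isAlgebraicCurvatureTensor_constCurv hg).smul 3) (h.basis hdim)
    ?_ ?_ ?_ ?_ ?_ ?_ ?_ ?_ ?_ ?_ ?_ ?_ ?_ ?_ ?_ ?_ ?_ ?_ ?_ ?_ <;>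
  · rw [coe_basis, quadCurv_apply]
    simp [Fin.sum_univ_three, para_apply, lorentz, h _ _] <;> norm_num

end IsNullFrame

/-! ### Trace conditions: Einstein, and one half Weyl tensor zero -/

namespace Model

variable [FiniteDimensional ℝ V] {M : Model V}

/-- Both `v` and `2v` are null, and the trace is multiplied by `4` on passing from one to the other.
-/
theorem IsNullJordanOsserman.trace_jacobi (h : M.IsNullJordanOsserman) {v : V}
    (hv : v ∈ M.nullCone) : LinearMap.trace ℝ V (M.jacobi v) = 0 := by
  have h2 : (2 : ℝ) • v ∈ M.nullCone := ⟨by simpa using hv.1, by simp [hv.2]⟩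
  have := (h v hv _ h2).trace_eq
  rw [jacobi_smul, map_smul, smul_eq_mul] at this
  linarith

theorem IsNullJordanOsserman.trace_jacobi_comp_self (h : M.IsNullJordanOsserman) {v : V}
    (hv : v ∈ M.nullCone) : LinearMap.trace ℝ V (M.jacobi v ∘ₗ M.jacobi v) = 0 := by
  have h2 : (2 : ℝ) • v ∈ M.nullCone := ⟨by simpa using hv.1, by simp [hv.2]⟩
  have := (h v hv _ h2).comp_self.trace_eq
  rw [jacobi_smul, LinearMap.comp_smul, LinearMap.smul_comp, map_smul, map_smul, smul_eq_mul,
    smul_eq_mul] at this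
  linarith

/-- On `b₀^⊥ / b₀`, with null basis `b₁, b₂`, vanishing trace leaves only the two entries exchanging
the basis vectors. The trace of the square is then twice their product. -/
theorem IsNullJordanOsserman.curv_mul_curv (h : M.IsNullJordanOsserman)
    (hdim : finrank ℝ V = 4) {b : Fin 4 → V} (hb : IsNullFrame M.form b) :
    M.curv (b 0) (b 1) (b 0) (b 1) * M.curv (b 0) (b 2) (b 0) (b 2) = 0 := by
  have hA := M.curv_isCurvature
  have hv : b 0 ∈ M.nullCone := ⟨hb.linearIndependent.ne_zero 0, by simp [hb _ _]⟩
  have h1 := h.trace_jacobi hv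
  have h2 := h.trace_jacobi_comp_self hv
  rw [hb.trace_eq hdim] at h1 h2
  have hsymm : ∀ y z, M.curv y (b 0) (b 0) z = M.curv z (b 0) (b 0) y := fun y z => by
    rw [hA.pair, hA.skew, hA.skew_right, neg_neg]
  have hJ0 : M.jacobi (b 0) (b 0) = 0 := M.jacobi_apply_eq fun z => by simp [hA.self_left]
  have hself : ∀ y z, M.form (M.jacobi (b 0) (M.jacobi (b 0) y)) z =
      M.form (M.jacobi (b 0) y) (M.jacobi (b 0) z) := fun y z => by
    rw [form_jacobi, hsymm, ← form_jacobi, M.form_symm.eq]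
  have h30 : M.form (M.jacobi (b 0) (b 3)) (b 0) = 0 := by
    rw [form_jacobi, hsymm, hA.self_left]
  have h21 : M.form (M.jacobi (b 0) (b 2)) (b 1) = M.form (M.jacobi (b 0) (b 1)) (b 2) := by
    rw [form_jacobi, hsymm, form_jacobi]
  simp only [hJ0, map_zero, LinearMap.zero_apply, h30, h21] at h1
  have h12 : M.form (M.jacobi (b 0) (b 1)) (b 2) = 0 := by linarith
  rw [h12] at h21
  have e1 := hb.eq_sum hdim (M.jacobi (b 0) (b 1))
  have e2 := hb.eq_sum hdim (M.jacobi (b 0) (b 2))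
  have h10 : M.form (M.jacobi (b 0) (b 1)) (b 0) = 0 := by
    rw [form_jacobi, hsymm, hA.self_left]
  have h20 : M.form (M.jacobi (b 0) (b 2)) (b 0) = 0 := by
    rw [form_jacobi, hsymm, hA.self_left]
  rw [h12, h10] at e1
  rw [h21, h20] at e2
  have h11 : M.form (M.jacobi (b 0) (b 1)) (b 1) = -M.curv (b 0) (b 1) (b 0) (b 1) := by
    rw [form_jacobi, hA.skew]
  have h22 : M.form (M.jacobi (b 0) (b 2)) (b 2) = -M.curv (b 0) (b 2) (b 0) (b 2) := by
    rw [form_jacobi, hA.skew]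
  have hprod : M.form (M.jacobi (b 0) (b 1)) (M.jacobi (b 0) (b 2)) =
      -(M.curv (b 0) (b 1) (b 0) (b 1) * M.curv (b 0) (b 2) (b 0) (b 2)) := by
    rw [e1, e2, h11, h22]
    simp [hb _ _]
  have hprod' := (M.form_symm.eq (M.jacobi (b 0) (b 2)) (M.jacobi (b 0) (b 1))).trans hprod
  simp only [LinearMap.comp_apply, hself, hJ0, map_zero, LinearMap.zero_apply, hprod, hprod'] at h2
  linarith

theorem exists_det_eq_one {α γ : ℝ} (h : α ≠ 0 ∨ γ ≠ 0) :
    ∃ β δ : ℝ, α * δ - β * γ = 1 := by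
  have hpos : 0 < α ^ 2 + γ ^ 2 := by
    rcases h with h | h <;> positivity
  refine ⟨-γ / (α ^ 2 + γ ^ 2), α / (α ^ 2 + γ ^ 2), ?_⟩
  field_simp
  ring

/-- One of the two half Weyl tensors vanishes. -/
theorem IsNullJordanOsserman.exists_isNullFrame (h : M.IsNullJordanOsserman)
    (hdim : finrank ℝ V = 4) {b : Fin 4 → V} (hb : IsNullFrame M.form b) :
    ∃ b, IsNullFrame M.form b ∧ ∀ α γ : ℝ, M.curv (α • b 0 + γ • b 1) (α • b 2 + γ • b 3)
      (α • b 0 + γ • b 1) (α • b 2 + γ • b 3) = 0 := by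
  have hA := M.curv_isCurvature
  by_cases hW : ∀ α γ : ℝ, M.curv (α • b 0 + γ • b 1) (α • b 2 + γ • b 3)
      (α • b 0 + γ • b 1) (α • b 2 + γ • b 3) = 0
  · exact ⟨b, hb, hW⟩
  · refine ⟨![b 0, b 2, b 1, b 3], hb.swap, fun α γ => ?_⟩
    push Not at hW
    obtain ⟨α', γ', hW⟩ := hW
    change M.curv (α • b 0 + γ • b 2) (α • b 1 + γ • b 3)
      (α • b 0 + γ • b 2) (α • b 1 + γ • b 3) = 0
    by_cases h0 : α = 0 ∧ γ = 0
    · simp [h0.1, h0.2]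
    have h0' : ¬(α' = 0 ∧ γ' = 0) := by
      rintro ⟨rfl, rfl⟩
      simp at hW
    obtain ⟨β, δ, hdet⟩ := exists_det_eq_one (not_and_or.1 h0)
    obtain ⟨β', δ', hdet'⟩ := exists_det_eq_one (not_and_or.1 h0')
    -- Rotating the two factors independently turns the product identity into a product of two
    -- quartics, in `(α, γ)` and `(α', γ')`; the second is non-zero at the chosen point, so the
    -- first vanishes everywhere.
    have key := h.curv_mul_curv hdim ((hb.rotate hdet).swap.rotate hdet')
    simp only [Matrix.cons_val] at key
    rw [hA.apply_plane, mul_comm γ' β', hdet', one_pow, one_mul] at key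
    have e : ∀ p q : ℝ, p • (α • b 0 + γ • b 2) + q • (α • b 1 + γ • b 3) =
        α • (p • b 0 + q • b 1) + γ • (p • b 2 + q • b 3) := fun p q => by module
    have e' : ∀ p q : ℝ, p • (β • b 0 + δ • b 2) + q • (β • b 1 + δ • b 3) =
        β • (p • b 0 + q • b 1) + δ • (p • b 2 + q • b 3) := fun p q => by module
    rw [e, e', hA.apply_plane, mul_comm γ β, hdet, one_pow, one_mul] at key
    exact (mul_eq_zero.1 key).resolve_left hW

end Model

/-! ### Reduction to a symmetric 3 × 3 matrix -/

namespace Model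

variable [FiniteDimensional ℝ V] {M : Model V}

/-- The linear relations between the components of a curvature tensor that is Einstein and has only
one half Weyl tensor. -/
theorem IsNullJordanOsserman.curv_components (h : M.IsNullJordanOsserman)
    (hdim : finrank ℝ V = 4) {b : Fin 4 → V} (hb : IsNullFrame M.form b)
    (hW : ∀ α γ : ℝ, M.curv (α • b 0 + γ • b 1) (α • b 2 + γ • b 3)
      (α • b 0 + γ • b 1) (α • b 2 + γ • b 3) = 0) :
    M.curv (b 0) (b 1) (b 0) (b 2) = 0 ∧
    M.curv (b 0) (b 1) (b 1) (b 2) = -M.curv (b 0) (b 1) (b 0) (b 3) ∧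
    M.curv (b 0) (b 1) (b 1) (b 3) = 0 ∧
    M.curv (b 0) (b 2) (b 0) (b 2) = 0 ∧
    M.curv (b 0) (b 2) (b 0) (b 3) = 0 ∧
    M.curv (b 0) (b 2) (b 1) (b 2) = 0 ∧
    M.curv (b 0) (b 2) (b 1) (b 3) = (M.curv (b 0) (b 1) (b 2) (b 3) - M.curv (b 0) (b 3) (b 0) (b 3)) / 2 ∧
    M.curv (b 0) (b 2) (b 2) (b 3) = 0 ∧
    M.curv (b 0) (b 3) (b 1) (b 3) = 0 ∧
    M.curv (b 1) (b 2) (b 1) (b 2) = M.curv (b 0) (b 3) (b 0) (b 3) ∧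
    M.curv (b 1) (b 2) (b 1) (b 3) = 0 ∧
    M.curv (b 1) (b 2) (b 2) (b 3) = -M.curv (b 0) (b 3) (b 2) (b 3) ∧
    M.curv (b 1) (b 3) (b 1) (b 3) = 0 ∧
    M.curv (b 1) (b 3) (b 2) (b 3) = 0 := by
  have hA := M.curv_isCurvature
  have hRic : ∀ v, v ≠ 0 → M.form v v = 0 → M.curv (b 0) v v (b 3) - M.curv (b 1) v v (b 2) -
      M.curv (b 2) v v (b 1) + M.curv (b 3) v v (b 0) = 0 := fun v h0 hv => by
    have := h.trace_jacobi (v := v) ⟨h0, hv⟩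
    rw [hb.trace_eq hdim] at this
    simpa only [form_jacobi] using this
  have hne : ∀ c : Fin 4 → ℝ, c ≠ 0 → ∑ i, c i • b i ≠ 0 := fun c hc h0 =>
    hc (funext fun i => Fintype.linearIndependent_iff.1 hb.linearIndependent c h0 i)
  have hRic' : ∀ c : Fin 4 → ℝ, c ≠ 0 → c 0 * c 3 = c 1 * c 2 →
      M.curv (b 0) (∑ i, c i • b i) (∑ i, c i • b i) (b 3) -
      M.curv (b 1) (∑ i, c i • b i) (∑ i, c i • b i) (b 2) -
      M.curv (b 2) (∑ i, c i • b i) (∑ i, c i • b i) (b 1) +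
      M.curv (b 3) (∑ i, c i • b i) (∑ i, c i • b i) (b 0) = 0 := fun c hc hc' => by
    refine hRic _ (hne c hc) ?_
    simp [Fin.sum_univ_four, hb _ _]
    linear_combination 2 * hc'
  have hc0 : ∀ (c : Fin 4 → ℝ) (i : Fin 4), c i = 1 → c ≠ 0 := fun c i hi h0 => by
    rw [h0] at hi
    simp at hi
  -- Nine null vectors detect all nine components of the trace-free Ricci tensor.
  have r0 := hRic' ![1, 0, 0, 0] (hc0 _ 0 rfl) (by simp)
  have r1 := hRic' ![0, 1, 0, 0] (hc0 _ 1 rfl) (by simp)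
  have r2 := hRic' ![0, 0, 1, 0] (hc0 _ 2 rfl) (by simp)
  have r3 := hRic' ![0, 0, 0, 1] (hc0 _ 3 rfl) (by simp)
  have r01 := hRic' ![1, 1, 0, 0] (hc0 _ 0 rfl) (by simp)
  have r23 := hRic' ![0, 0, 1, 1] (hc0 _ 2 rfl) (by simp)
  have r02 := hRic' ![1, 0, 1, 0] (hc0 _ 0 rfl) (by simp)
  have r13 := hRic' ![0, 1, 0, 1] (hc0 _ 1 rfl) (by simp)
  have r0123 := hRic' ![1, 1, 1, 1] (hc0 _ 0 rfl) (by simp)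
  -- Five values determine the five coefficients of a binary quartic.
  have w0 := hW 1 0
  have w1 := hW 0 1
  have w2 := hW 1 1
  have w3 := hW 1 (-1)
  have w4 := hW 1 2
  have e1 := hA.bianchi (b 0) (b 1) (b 2) (b 3)
  simp only [Fin.sum_univ_four, Matrix.cons_val, one_smul, zero_smul, add_zero, zero_add, map_add,
    LinearMap.add_apply, map_smul, LinearMap.smul_apply, smul_eq_mul, hA.self_left, hA.self_right,
    hA.skew (b 1) (b 0), hA.skew (b 2) (b 0), hA.skew (b 3) (b 0), hA.skew (b 2) (b 1),
    hA.skew (b 3) (b 1), hA.skew (b 3) (b 2), hA.skew_right _ _ (b 1) (b 0),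
    hA.skew_right _ _ (b 2) (b 0), hA.skew_right _ _ (b 3) (b 0), hA.skew_right _ _ (b 2) (b 1),
    hA.skew_right _ _ (b 3) (b 1), hA.skew_right _ _ (b 3) (b 2),
    hA.pair (b 0) (b 2) (b 0) (b 1), hA.pair (b 0) (b 3) (b 0) (b 1),
    hA.pair (b 1) (b 2) (b 0) (b 1), hA.pair (b 1) (b 3) (b 0) (b 1),
    hA.pair (b 2) (b 3) (b 0) (b 1), hA.pair (b 0) (b 3) (b 0) (b 2),
    hA.pair (b 1) (b 2) (b 0) (b 2), hA.pair (b 1) (b 3) (b 0) (b 2),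
    hA.pair (b 2) (b 3) (b 0) (b 2), hA.pair (b 1) (b 2) (b 0) (b 3),
    hA.pair (b 1) (b 3) (b 0) (b 3), hA.pair (b 2) (b 3) (b 0) (b 3),
    hA.pair (b 1) (b 3) (b 1) (b 2), hA.pair (b 2) (b 3) (b 1) (b 2),
    hA.pair (b 2) (b 3) (b 1) (b 3)]
    at r0 r1 r2 r3 r01 r23 r02 r13 r0123 w0 w1 w2 w3 w4 e1
  refine ⟨?_, ?_, ?_, ?_, ?_, ?_, ?_, ?_, ?_, ?_, ?_, ?_, ?_, ?_⟩ <;> linarith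

theorem IsNullJordanOsserman.exists_quadCurv (h : M.IsNullJordanOsserman)
    (hdim : finrank ℝ V = 4) {b : Fin 4 → V} (hb : IsNullFrame M.form b)
    (hW : ∀ α γ : ℝ, M.curv (α • b 0 + γ • b 1) (α • b 2 + γ • b 3)
      (α • b 0 + γ • b 1) (α • b 2 + γ • b 3) = 0) :
    ∃ m : Matrix (Fin 3) (Fin 3) ℝ, m.IsSymm ∧ M.curv = quadCurv M.form m (hb.para hdim) := by
  have hA := M.curv_isCurvature
  obtain ⟨h0102, h0112, h0113, h0202, h0203, h0212, h0213, h0223, h0313, h1212, h1213, h1223, h1313,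
    h1323⟩ := h.curv_components hdim hb hW
  -- The six surviving components are an invertible linear function of the six entries of `m`.
  obtain ⟨m00, m01, m02, m11, m12, m22, q0101, q0103, q0123, q0303, q0323, q2323⟩ :
      ∃ m00 m01 m02 m11 m12 m22 : ℝ,
        M.curv (b 0) (b 1) (b 0) (b 1) = -3 * m00 - 6 * m02 - 3 * m22 ∧
        M.curv (b 0) (b 1) (b 0) (b 3) = 3 * m01 + 3 * m12 ∧
        M.curv (b 0) (b 1) (b 2) (b 3) = -2 * m00 - m11 + 2 * m22 ∧
        M.curv (b 0) (b 3) (b 0) (b 3) = -3 * m11 ∧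
        M.curv (b 0) (b 3) (b 2) (b 3) = 3 * m01 - 3 * m12 ∧
        M.curv (b 2) (b 3) (b 2) (b 3) = -3 * m00 + 6 * m02 - 3 * m22 := by
    generalize M.curv (b 0) (b 1) (b 0) (b 1) = x
    generalize M.curv (b 0) (b 1) (b 0) (b 3) = y
    generalize M.curv (b 0) (b 1) (b 2) (b 3) = z
    generalize M.curv (b 0) (b 3) (b 0) (b 3) = w
    generalize M.curv (b 0) (b 3) (b 2) (b 3) = u
    generalize M.curv (b 2) (b 3) (b 2) (b 3) = t
    refine ⟨-(x + t) / 12 - (z - w / 3) / 4, (y + u) / 6, (t - x) / 12, -w / 3, (y - u) / 6,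
      -(x + t) / 12 + (z - w / 3) / 4, ?_, ?_, ?_, ?_, ?_, ?_⟩ <;> ring
  have hm : (!![m00, m01, m02; m01, m11, m12; m02, m12, m22]).IsSymm := by
    ext i j
    fin_cases i <;> fin_cases j <;> rfl
  refine ⟨_, hm, hA.ext_of_basis
    (isAlgebraicCurvatureTensor_quadCurv M.form_symm hm (hb.para_isSkewAdjoint hdim))
    (hb.basis hdim) ?_ ?_ ?_ ?_ ?_ ?_ ?_ ?_ ?_ ?_ ?_ ?_ ?_ ?_ ?_ ?_ ?_ ?_ ?_ ?_⟩
  all_goals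
    rw [hb.coe_basis, quadCurv_apply]
    simp only [Fin.sum_univ_three, hb.para_apply, Matrix.cons_val, map_neg, LinearMap.neg_apply,
      hb _ _, Matrix.of_apply, Matrix.cons_val', h0102, h0112, h0113, h0202, h0203, h0212, h0213,
      h0223, h0313, h1212, h1213, h1223, h1313, h1323, q0101, q0103, q0123, q0303, q0323, q2323]
    ring

end Model

/-- Every null vector of the Lorentz form is a multiple of a square of a spinor. -/
theorem exists_spinor {n : Fin 3 → ℝ} (hn : n ≠ 0) (h : lorentzNorm n = 0) :
    n 0 ≠ 0 ∧ ∃ C S : ℝ, C ^ 2 + S ^ 2 = 1 ∧ n 1 = n 0 * (2 * C * S) ∧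
      n 2 = n 0 * (S ^ 2 - C ^ 2) := by
  rw [lorentzNorm] at h
  have h0 : n 0 ≠ 0 := by
    intro h0
    rw [h0] at h
    have h1 : n 1 = 0 := by nlinarith [sq_nonneg (n 1), sq_nonneg (n 2)]
    have h2 : n 2 = 0 := by nlinarith [sq_nonneg (n 1), sq_nonneg (n 2)]
    apply hn
    ext i
    fin_cases i <;> assumption
  -- This normalization makes `∑ nᵢ Ψᵢ` annihilate `C b₀ + S b₂` for the standard structure of a
  -- null frame.
  obtain ⟨C, S, h1, h2, h3⟩ := exists_half_angle (x := -n 2 / n 0) (y := n 1 / n 0) (by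
    field_simp
    linarith)
  refine ⟨h0, C, S, h1, ?_, ?_⟩
  · rw [h3]
    field_simp
  · rw [← neg_sub, h2]
    field_simp

/-! ### Jacobi operators along a null plane -/

namespace Model

variable {M : Model V}

section Frame

variable {b : Fin 4 → V}

theorem spinor_mem_nullCone (hb : IsNullFrame M.form b) {C S : ℝ} (hCS : C ^ 2 + S ^ 2 = 1) :
    C • b 0 + S • b 2 ∈ M.nullCone := by
  refine ⟨fun h0 => ?_, by simp [hb _ _]⟩
  have h1 := congrArg (fun x => M.form x (b 3)) h0
  have h2 := congrArg (fun x => M.form x (b 1)) h0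
  simp [hb _ _] at h1 h2
  simp [h1, h2] at hCS

theorem smul_add_smul_eq_zero_iff (hb : IsNullFrame M.form b) {s t : ℝ} :
    s • b 0 + t • b 2 = 0 ↔ s = 0 ∧ t = 0 := by
  refine ⟨fun h0 => ?_, fun h => by simp [h.1, h.2]⟩
  have h1 := congrArg (fun x => M.form x (b 3)) h0
  have h2 := congrArg (fun x => M.form x (b 1)) h0
  simp [hb _ _] at h1 h2
  exact ⟨h1, h2⟩

theorem eq_of_frame (hb : IsNullFrame M.form b) (hdim : finrank ℝ V = 4) (x : V) :
    ∃ p q r t : ℝ, x = (p • b 0 + q • b 2) + (r • b 1 + t • b 3) := by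
  refine ⟨M.form x (b 3), -M.form x (b 1), -M.form x (b 2), M.form x (b 0),
    (hb.eq_sum hdim x).trans ?_⟩
  module

variable [FiniteDimensional ℝ V] {hdim : finrank ℝ V = 4} {hb : IsNullFrame M.form b}
  {m : Matrix (Fin 3) (Fin 3) ℝ}

/-- The plane of `b₀` and `b₂` is isotropic and preserved by each `Ψᵢ`, so every pairing `⟨y, Ψᵢ v⟩`
is zero. Only the complementary plane of `b₁` and `b₃` contributes to the rank. -/
theorem jacobi_spinor_left (hm : m.IsSymm) (hA : M.curv = quadCurv M.form m (hb.para hdim))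
    (C S p q : ℝ) : M.jacobi (C • b 0 + S • b 2) (p • b 0 + q • b 2) = 0 := by
  rw [jacobi_quadCurv hm (hb.para_isSkewAdjoint hdim) hA]
  have : (fun i => M.form (p • b 0 + q • b 2) (hb.para hdim i (C • b 0 + S • b 2))) = 0 := by
    ext i
    fin_cases i <;> simp [hb.para_apply, hb _ _]
  rw [this, Matrix.mulVec_zero]
  simp

theorem jacobi_spinor_right (hm : m.IsSymm) (hA : M.curv = quadCurv M.form m (hb.para hdim))
    (C S p q : ℝ) {U : Fin 3 → ℝ}
    (hU : m.mulVec ![-p * C - q * S, p * S + q * C, -p * C + q * S] = U) :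
    M.jacobi (C • b 0 + S • b 2) (p • b 1 + q • b 3) =
      (3 * (-U 0 * S + U 1 * C + U 2 * S)) • b 0 + (3 * (U 0 * C - U 1 * S + U 2 * C)) • b 2 := by
  rw [jacobi_quadCurv hm (hb.para_isSkewAdjoint hdim) hA]
  have : (fun i => M.form (p • b 1 + q • b 3) (hb.para hdim i (C • b 0 + S • b 2))) =
      ![-p * C - q * S, p * S + q * C, -p * C + q * S] := by
    ext i
    fin_cases i <;> (simp [hb.para_apply, hb _ _]; try ring)
  rw [this, hU]
  simp [Fin.sum_univ_three, hb.para_apply]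
  module

/-- The restricted Jacobi operators of the null vectors of a null plane are all injective or all
non-injective. -/
theorem IsNullJordanOsserman.injective_or (h : M.IsNullJordanOsserman) (hm : m.IsSymm)
    (hA : M.curv = quadCurv M.form m (hb.para hdim)) :
    (∀ C S : ℝ, C ^ 2 + S ^ 2 = 1 → ∀ p q : ℝ,
      M.jacobi (C • b 0 + S • b 2) (p • b 1 + q • b 3) = 0 → p = 0 ∧ q = 0) ∨
    (∀ C S : ℝ, C ^ 2 + S ^ 2 = 1 → ∃ p q : ℝ,
      M.jacobi (C • b 0 + S • b 2) (p • b 1 + q • b 3) = 0 ∧ (p ≠ 0 ∨ q ≠ 0)) := by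
  by_contra! hcon
  obtain ⟨⟨C, S, hCS, p, q, hJ, hpq⟩, C', S', hCS', hinj⟩ := hcon
  have hfr := (h _ (spinor_mem_nullCone hb hCS) _ (spinor_mem_nullCone hb hCS')).finrank_ker_eq
  have hle : LinearMap.ker (M.jacobi (C' • b 0 + S' • b 2)) ≤
      Submodule.span ℝ (Set.range ![b 0, b 2]) := by
    intro x hx
    obtain ⟨s, t, r, u, rfl⟩ := eq_of_frame hb hdim x
    rw [LinearMap.mem_ker, map_add, jacobi_spinor_left hm hA, zero_add] at hx
    have hr : r = 0 := (hinj r u hx).1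
    have hu : u = 0 := (hinj r u hx).2
    subst hr hu
    simp only [zero_smul, add_zero]
    exact Submodule.add_mem _ (Submodule.smul_mem _ _ (Submodule.subset_span ⟨0, rfl⟩))
      (Submodule.smul_mem _ _ (Submodule.subset_span ⟨1, rfl⟩))
  -- Every kernel contains the plane of `b₀` and `b₂`; it has dimension two in the injective case
  -- and at least three otherwise.
  have h2 : finrank ℝ (LinearMap.ker (M.jacobi (C' • b 0 + S' • b 2))) ≤ 2 :=
    (Submodule.finrank_mono hle).trans (finrank_range_le_card (R := ℝ) ![b 0, b 2])
  have hind : LinearIndependent ℝ ![b 0, b 2, p • b 1 + q • b 3] := by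
    rw [Fintype.linearIndependent_iff]
    intro c hc
    simp only [Fin.sum_univ_three, Matrix.cons_val] at hc
    have k0 := congrArg (fun x => M.form x (b 3)) hc
    have k1 := congrArg (fun x => M.form x (b 1)) hc
    have k2 := congrArg (fun x => M.form x (b 2)) hc
    have k3 := congrArg (fun x => M.form x (b 0)) hc
    simp [hb _ _] at k0 k1 k2 k3
    have hc2 : c 2 = 0 := by
      by_contra hne
      exact hpq (k2.resolve_left hne) (k3.resolve_left hne)
    intro i
    fin_cases i <;> assumption
  have h3 : 3 ≤ finrank ℝ (LinearMap.ker (M.jacobi (C • b 0 + S • b 2))) := by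
    have hle' : Submodule.span ℝ (Set.range ![b 0, b 2, p • b 1 + q • b 3]) ≤
        LinearMap.ker (M.jacobi (C • b 0 + S • b 2)) := by
      rw [Submodule.span_le]
      rintro _ ⟨i, rfl⟩
      fin_cases i
      · simpa using jacobi_spinor_left (hb := hb) hm hA C S 1 0
      · simpa using jacobi_spinor_left (hb := hb) hm hA C S 0 1
      · exact hJ
    have := Submodule.finrank_mono hle'
    rwa [finrank_span_eq_card hind, Fintype.card_fin] at this
  omega

/-- As `y` runs over the plane of `b₁` and `b₃`, the covector `⟨y, Ψᵢ v⟩` runs over the annihilator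
of `n`. If `m` sends it to a multiple of `n`, then `𝒥(v) y` is a multiple of `∑ nⱼ Ψⱼ v = 0`. -/
theorem isNullNondegenerate_of_injective (hm : m.IsSymm)
    (hA : M.curv = quadCurv M.form m (hb.para hdim))
    (h : ∀ C S : ℝ, C ^ 2 + S ^ 2 = 1 → ∀ p q : ℝ,
      M.jacobi (C • b 0 + S • b 2) (p • b 1 + q • b 3) = 0 → p = 0 ∧ q = 0) :
    IsNullNondegenerate m := by
  intro n u μ hn hnull hu hun hmu
  obtain ⟨h0, C, S, hCS, h1, h2⟩ := exists_spinor hn hnull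
  have hu0 : u 0 = -2 * C * S * u 1 + (C ^ 2 - S ^ 2) * u 2 := by
    simp only [dotProduct, Fin.sum_univ_three, h1, h2] at hun
    apply mul_left_cancel₀ h0
    linear_combination hun
  have hueq : ![-(S * u 1 - C * u 2) * C - (C * u 1 + S * u 2) * S,
      (S * u 1 - C * u 2) * S + (C * u 1 + S * u 2) * C,
      -(S * u 1 - C * u 2) * C + (C * u 1 + S * u 2) * S] = u := by
    ext i
    fin_cases i
    · simp [hu0]
      ring
    · simp
      linear_combination u 1 * hCS
    · simp
      linear_combination u 2 * hCS
  have hJ := jacobi_spinor_right (hb := hb) hm hA C S (S * u 1 - C * u 2) (C * u 1 + S * u 2)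
    (U := μ • n) (by rw [hueq, hmu])
  have hJ0 : M.jacobi (C • b 0 + S • b 2) ((S * u 1 - C * u 2) • b 1 + (C * u 1 + S * u 2) • b 3)
      = 0 := by
    rw [hJ, smul_add_smul_eq_zero_iff hb]
    simp only [Pi.smul_apply, smul_eq_mul, h1, h2]
    constructor
    · linear_combination 3 * μ * n 0 * S * hCS
    · linear_combination -3 * μ * n 0 * C * hCS
  obtain ⟨hp, hq⟩ := h C S hCS _ _ hJ0
  rw [hp, hq] at hueq
  apply hu
  rw [← hueq]
  simp

theorem nullDet_eq_zero_of_not_injective (hm : m.IsSymm)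
    (hA : M.curv = quadCurv M.form m (hb.para hdim))
    (h : ∀ C S : ℝ, C ^ 2 + S ^ 2 = 1 → ∃ p q : ℝ,
      M.jacobi (C • b 0 + S • b 2) (p • b 1 + q • b 3) = 0 ∧ (p ≠ 0 ∨ q ≠ 0))
    (C' S' : ℝ) (hCS' : C' ^ 2 + S' ^ 2 = 1) : nullDet m C' S' = 0 := by
  -- The vector `C b₀ + S b₂` is the one annihilated by the null direction `(1, C', S')`.
  obtain ⟨C, S, hCS, h1, h2⟩ := exists_half_angle (x := -S') (y := C') (by linarith)
  obtain ⟨p, q, hJ, hpq⟩ := h C S hCS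
  set f : Fin 3 → ℝ := ![-1, C', S'] with hf
  set e : Fin 3 → ℝ := ![0, -S', C'] with he
  set s := p * C + q * S with hs
  set t := -S' * (p * S + q * C) + C' * (-p * C + q * S) with ht
  have hu : ![-p * C - q * S, p * S + q * C, -p * C + q * S] = s • f + t • e := by
    have hperp : s = C' * (p * S + q * C) + S' * (-p * C + q * S) := by
      rw [show S' = S ^ 2 - C ^ 2 by linarith, ← h2, hs]
      linear_combination -(p * C + q * S) * hCS
    ext i
    fin_cases i
    · simp [hs, hf, he]
      ring
    · simp only [Fin.mk_one, Matrix.cons_val, hf, he, Pi.add_apply, Pi.smul_apply,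
        smul_eq_mul, ht]
      linear_combination -C' * hperp - (p * S + q * C) * hCS'
    · simp only [Fin.reduceFinMk, Matrix.cons_val, hf, he, Pi.add_apply, Pi.smul_apply,
        smul_eq_mul, ht]
      linear_combination -S' * hperp - (-p * C + q * S) * hCS'
  set U := m.mulVec (s • f + t • e) with hU
  rw [jacobi_spinor_right hm hA C S p q (U := U) (by rw [hu]), smul_add_smul_eq_zero_iff hb] at hJ
  obtain ⟨j1, j2⟩ := hJ
  have hfU : dotProduct f U = 0 := by
    simp [hf, dotProduct, Fin.sum_univ_three]
    rw [show S' = S ^ 2 - C ^ 2 by linarith, ← h2]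
    linear_combination (S / 3) * j1 - (C / 3) * j2 + U 0 * hCS
  have heU : dotProduct e U = 0 := by
    simp [he, dotProduct, Fin.sum_univ_three]
    rw [show S' = S ^ 2 - C ^ 2 by linarith, ← h2]
    linear_combination (C / 3) * j1 + (S / 3) * j2
  rw [hU, Matrix.mulVec_add, Matrix.mulVec_smul, Matrix.mulVec_smul, dotProduct_add,
    dotProduct_smul, dotProduct_smul, smul_eq_mul, smul_eq_mul] at hfU heU
  have hst : s ≠ 0 ∨ t ≠ 0 := by
    by_contra! hst
    rw [hst.1, hst.2] at hu
    have k1 : p * S + q * C = 0 := by simpa using congrFun hu 1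
    have k2 : -p * C + q * S = 0 := by simpa using congrFun hu 2
    have kp : p = 0 := by linear_combination S * k1 - C * k2 - p * hCS
    have kq : q = 0 := by linear_combination C * k1 + S * k2 - q * hCS
    simp [kp, kq] at hpq
  -- `(s, t)` is a non-zero kernel vector of the Gram matrix of `m` on the annihilator; eliminating
  -- one unknown shows that its determinant is zero.
  rw [nullDet]
  rcases hst with hst | hst
  · apply mul_left_cancel₀ hst
    linear_combination dotProduct e (m.mulVec e) * hfU - dotProduct f (m.mulVec e) * heU
  · apply mul_left_cancel₀ hst
    linear_combination dotProduct f (m.mulVec f) * heU - dotProduct e (m.mulVec f) * hfU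

/-- A null `l` would annihilate some null `v`, and `𝒥(v)`, whose values are multiples of `∑ lⱼ Ψⱼ
v`, would be zero. All null Jacobi operators would then vanish, and testing at `b₀` and `b₂` gives
`l₀ ± l₂ = 0`, impossible since `l₀ ≠ 0`. -/
theorem IsNullJordanOsserman.lorentzNorm_ne_zero (h : M.IsNullJordanOsserman) {σ : ℝ}
    {l : Fin 3 → ℝ} (hσ : σ ≠ 0) (hl : l ≠ 0)
    (hA : M.curv = quadCurv M.form (Matrix.of fun i j => σ * (l i * l j)) (hb.para hdim)) :
    lorentzNorm l ≠ 0 := by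
  intro hnull
  set m : Matrix (Fin 3) (Fin 3) ℝ := Matrix.of fun i j => σ * (l i * l j) with hmdef
  have hm : m.IsSymm := by
    ext i j
    simp [hmdef, mul_comm]
  have hmu : ∀ u, m.mulVec u = (σ * dotProduct l u) • l := fun u => by
    ext i
    simp [hmdef, Matrix.mulVec, dotProduct, Fin.sum_univ_three]
    ring
  obtain ⟨h0, C, S, hCS, h1, h2⟩ := exists_spinor hl hnull
  have hJ0 : M.jacobi (C • b 0 + S • b 2) = 0 := by
    ext x
    obtain ⟨p, q, r, t, rfl⟩ := eq_of_frame hb hdim x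
    rw [map_add, jacobi_spinor_left hm hA, jacobi_spinor_right hm hA C S r t (hmu _), zero_add,
      LinearMap.zero_apply, smul_add_smul_eq_zero_iff hb]
    generalize σ * dotProduct l _ = w
    simp only [Pi.smul_apply, smul_eq_mul, h1, h2]
    constructor
    · linear_combination 3 * w * l 0 * S * hCS
    · linear_combination -3 * w * l 0 * C * hCS
  have hall : ∀ v ∈ M.nullCone, M.jacobi v = 0 := fun v hv => by
    obtain ⟨φ, hφ⟩ := h v hv _ (spinor_mem_nullCone hb hCS)
    rw [hJ0, LinearMap.zero_comp] at hφ
    ext y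
    have := LinearMap.congr_fun hφ y
    simpa using this
  have k1 := jacobi_spinor_right (hb := hb) hm hA 1 0 1 0 (hmu _)
  rw [hall _ (spinor_mem_nullCone hb (by norm_num)), LinearMap.zero_apply, eq_comm,
    smul_add_smul_eq_zero_iff hb] at k1
  have k2 := jacobi_spinor_right (hb := hb) hm hA 0 1 0 1 (hmu _)
  rw [hall _ (spinor_mem_nullCone hb (by norm_num)), LinearMap.zero_apply, eq_comm,
    smul_add_smul_eq_zero_iff hb] at k2
  have j1 := k1.2
  have j2 := k2.1
  simp [dotProduct, Fin.sum_univ_three] at j1 j2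
  have e1 : σ * (l 0 + l 2) ^ 2 = 0 := by linear_combination -j1
  have e2 : σ * (l 0 - l 2) ^ 2 = 0 := by linear_combination j2
  have f1 : l 0 + l 2 = 0 := by simpa [hσ] using e1
  have f2 : l 0 - l 2 = 0 := by simpa [hσ] using e2
  exact h0 (by linarith)

end Frame

/-- The curvature tensor of a null Jordan Osserman model is a combination of the tensors of a
paraquaternionic structure. -/
theorem IsNullJordanOsserman.exists_paraquaternionic [FiniteDimensional ℝ V]
    (h : M.IsNullJordanOsserman)
    (hdim : finrank ℝ V = 4) (hsig : M.HasSignature 2 2) :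
    ∃ (κ : Fin 3 → ℝ) (Φ : Fin 3 → V →ₗ[ℝ] V), IsParaquaternionic M.form (Φ 0) (Φ 1) (Φ 2) ∧
      M.curv = κ 0 • endoCurv M.form (Φ 0) + κ 1 • endoCurv M.form (Φ 1) +
        κ 2 • endoCurv M.form (Φ 2) ∧
      (3 : ℝ) • constCurv M.form = endoCurv M.form (Φ 0) + (-1 : ℝ) • endoCurv M.form (Φ 1) +
        (-1 : ℝ) • endoCurv M.form (Φ 2) ∧
      (0 < κ 1 * κ 2 * (κ 1 + κ 0) * (κ 2 + κ 0) ∨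
        κ 1 * (κ 2 + κ 0) = 0 ∧ κ 2 * (κ 1 + κ 0) = 0) := by
  obtain ⟨b', hb'⟩ := hsig.exists_isNullFrame
  obtain ⟨b, hb, hW⟩ := h.exists_isNullFrame hdim hb'
  obtain ⟨m, hm, hA⟩ := h.exists_quadCurv hdim hb hW
  suffices hX : ∃ X κ, IsLorentzFrame X ∧ m = X.transpose * Matrix.diagonal κ * X ∧
      (0 < κ 1 * κ 2 * (κ 1 + κ 0) * (κ 2 + κ 0) ∨
        κ 1 * (κ 2 + κ 0) = 0 ∧ κ 2 * (κ 1 + κ 0) = 0) by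
    obtain ⟨X, κ, hX, rfl, hκ⟩ := hX
    refine ⟨κ, fun k => ∑ i, X k i • hb.para hdim i,
      (hb.para_isParaquaternionic hdim).congr hX, ?_, ?_, hκ⟩
    · rw [hA, quadCurv_congr_diagonal, Fin.sum_univ_three]
    · have hη : lorentz = X.transpose * Matrix.diagonal ![1, -1, -1] * X := by
        have h1 := hX.transpose_mul
        have h2 : X.transpose * (lorentz * X * lorentz) * lorentz = X.transpose * lorentz * X := by
          simp only [Matrix.mul_assoc, lorentz_mul_self, Matrix.mul_one]
        rw [h1, Matrix.one_mul] at h2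
        exact h2
      rw [← hb.quadCurv_lorentz M.form_symm hdim, hη, quadCurv_congr_diagonal, Fin.sum_univ_three]
      simp
  rcases h.injective_or hm hA with hinj | hninj
  · have hnd := isNullNondegenerate_of_injective hm hA hinj
    obtain ⟨X, κ, hX, rfl⟩ := hnd.isLorentzDiagonalizable hm
    exact ⟨X, κ, hX, rfl, Or.inl (hX.isNullNondegenerate hnd).diagonal_pos⟩
  · rcases eq_smul_lorentz_or_eq_square hm (nullDet_eq_zero_of_not_injective hm hA hninj) with
      ⟨c, rfl⟩ | ⟨σ, l, rfl⟩
    · refine ⟨1, ![c, -c, -c], IsLorentzFrame.one, ?_, Or.inr ?_⟩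
      · rw [Matrix.transpose_one, Matrix.one_mul, Matrix.mul_one, lorentz]
        ext i j
        fin_cases i <;> fin_cases j <;> simp
      · simp
    · by_cases h0 : σ = 0 ∨ l = 0
      · refine ⟨1, 0, IsLorentzFrame.one, ?_, Or.inr (by simp)⟩
        rcases h0 with rfl | rfl
        · ext i j
          simp
        · ext i j
          simp
      · push Not at h0
        have hN := h.lorentzNorm_ne_zero h0.1 h0.2 hA
        have hnorm : ∀ t : ℝ, lorentzNorm (t • l) = t ^ 2 * lorentzNorm l := fun t => by
          simp [lorentzNorm]
          ring
        rcases lt_or_gt_of_ne hN with hneg | hpos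
        · set ρ := √(-lorentzNorm l) with hρ
          have hρ0 : ρ ≠ 0 := (Real.sqrt_pos.2 (by linarith)).ne'
          have hρ2 : ρ ^ 2 = -lorentzNorm l := Real.sq_sqrt (by linarith)
          obtain ⟨X, hX, hXx⟩ := exists_frame_of_spacelike (x := ρ⁻¹ • l) (by
            rw [hnorm, inv_pow, hρ2]
            field_simp)
          -- With `l` normalized as the last frame vector, the rank-one form is diagonal with a
          -- single entry; the factor `ρ ^ 2` undoes the normalization.
          refine ⟨X, ![0, 0, σ * ρ ^ 2], hX, ?_, Or.inr (by simp)⟩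
          have hXi : ∀ i, X 2 i = ρ⁻¹ * l i := fun i => by simp [hXx]
          ext i j
          rw [Matrix.mul_apply, Fin.sum_univ_three]
          simp only [Matrix.mul_diagonal, Matrix.transpose_apply, Matrix.of_apply, hXi]
          simp
          field_simp
        · set ρ := √(lorentzNorm l) with hρ
          have hρ0 : ρ ≠ 0 := (Real.sqrt_pos.2 (by linarith)).ne'
          have hρ2 : ρ ^ 2 = lorentzNorm l := Real.sq_sqrt (by linarith)
          obtain ⟨X, hX, hXx⟩ := exists_frame_of_timelike (x := ρ⁻¹ • l) (by
            rw [hnorm, inv_pow, hρ2]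
            field_simp)
          refine ⟨X, ![σ * ρ ^ 2, 0, 0], hX, ?_, Or.inr (by simp)⟩
          have hXi : ∀ i, X 0 i = ρ⁻¹ * l i := fun i => by simp [hXx]
          ext i j
          rw [Matrix.mul_apply, Fin.sum_univ_three]
          simp only [Matrix.mul_diagonal, Matrix.transpose_apply, Matrix.of_apply, hXi]
          simp
          field_simp

end Model

end NullOsserman

/-! ### Sorting the diagonal forms into the four cases -/

theorem theorem1p3 {V : Type*} [AddCommGroup V] [Module ℝ V] [FiniteDimensional ℝ V]
    (hdim : Module.finrank ℝ V = 4)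
    (M : NullOsserman.Model V) (hsig : M.HasSignature 2 2) :
    M.IsNullJordanOsserman ↔
      M.IsTypeIa ∧
        ((∃ κ₀ : ℝ, M.curv = κ₀ • NullOsserman.constCurv M.form) ∨
         (∃ (κ₀ κJ : ℝ) (J : V →ₗ[ℝ] V), κJ ≠ 0 ∧
            NullOsserman.IsOrthogonalComplex M.form J ∧
            M.curv = κ₀ • NullOsserman.constCurv M.form + κJ • NullOsserman.endoCurv M.form J) ∨
         (∃ (κP : ℝ) (P : V →ₗ[ℝ] V), κP ≠ 0 ∧
            NullOsserman.IsAdaptedParacomplex M.form P ∧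
            M.curv = κP • NullOsserman.endoCurv M.form P) ∨
         (∃ (κ₁ κ₂ κ₃ : ℝ) (Ψ₁ Ψ₂ Ψ₃ : V →ₗ[ℝ] V),
            κ₂ * κ₃ * (κ₂ + κ₁) * (κ₃ + κ₁) > 0 ∧
            (3 * κ₁ ≠ -3 * κ₂ ∧ 3 * κ₁ ≠ -3 * κ₃ ∧ -3 * κ₂ ≠ -3 * κ₃) ∧
            NullOsserman.IsParaquaternionic M.form Ψ₁ Ψ₂ Ψ₃ ∧
            M.curv = κ₁ • NullOsserman.endoCurv M.form Ψ₁ +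
              κ₂ • NullOsserman.endoCurv M.form Ψ₂ +
              κ₃ • NullOsserman.endoCurv M.form Ψ₃)) := by
  constructor
  · intro h
    obtain ⟨κ, Φ, hΦ, hA, hconst, hκ⟩ := h.exists_paraquaternionic hdim hsig
    refine ⟨NullOsserman.Model.isTypeIa_paraquaternionic hdim hΦ hA, ?_⟩
    rcases hκ with hpos | ⟨hP, hQ⟩
    · have h10 : κ 1 + κ 0 ≠ 0 := fun h0 => by simp [h0] at hpos
      have h20 : κ 2 + κ 0 ≠ 0 := fun h0 => by simp [h0] at hpos
      rcases eq_or_ne (κ 1) (κ 2) with h12 | h12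
      -- With `κ₂ = κ₃`, substituting `A^{Ψ₂} + A^{Ψ₃} = A^{Ψ₁} - 3A⁰` leaves only `A⁰` and
      -- `A^{Ψ₁}`.
      · refine Or.inr (Or.inl ⟨-3 * κ 1, κ 1 + κ 0, Φ 0, h10, hΦ.complex₁, ?_⟩)
        rw [hA, mul_comm, mul_smul, ← neg_one_smul ℝ (3 : ℝ), smul_assoc, hconst, ← h12]
        module
      · refine Or.inr (Or.inr (Or.inr ⟨κ 0, κ 1, κ 2, Φ 0, Φ 1, Φ 2, hpos, ⟨?_, ?_, ?_⟩, hΦ, hA⟩))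
        · exact fun h0 => h10 (by linarith)
        · exact fun h0 => h20 (by linarith)
        · exact fun h0 => h12 (by linarith)
    · rcases eq_or_ne (κ 1) 0 with h1 | h1
      · rcases eq_or_ne (κ 2) 0 with h2 | h2
        · rcases eq_or_ne (κ 0) 0 with h0 | h0
          · exact Or.inl ⟨0, by rw [hA, h0, h1, h2]; simp⟩
          · exact Or.inr (Or.inl ⟨0, κ 0, Φ 0, h0, hΦ.complex₁, by rw [hA, h1, h2]; simp⟩)
        · have h0 : κ 0 = 0 := by simpa [h1, h2] using hQ
          exact Or.inr (Or.inr (Or.inl ⟨κ 2, Φ 2, h2, hΦ.para₃, by rw [hA, h1, h0]; simp⟩))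
      · have h20 : κ 2 = -κ 0 := by
          have : κ 2 + κ 0 = 0 := by simpa [h1] using hP
          linarith
        rcases eq_or_ne (κ 2) 0 with h2 | h2
        · have h0 : κ 0 = 0 := by linarith
          exact Or.inr (Or.inr (Or.inl ⟨κ 1, Φ 1, h1, hΦ.para₂, by rw [hA, h2, h0]; simp⟩))
        · have h10 : κ 1 = -κ 0 := by
            have : κ 1 + κ 0 = 0 := by simpa [h2] using hQ
            linarith
          -- The coefficients are proportional to `(1, -1, -1)`, which is the expansion of `3A⁰`.
          refine Or.inl ⟨κ 0 * 3, ?_⟩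
          rw [mul_smul, hconst, hA, h10, h20]
          module
  · rintro ⟨-, ⟨κ₀, hA⟩ | ⟨κ₀, κJ, J, hκ, hJ, hA⟩ | ⟨κP, P, -, hP, hA⟩ |
      ⟨κ₁, κ₂, κ₃, Ψ₁, Ψ₂, Ψ₃, hκ, -, hΨ, hA⟩⟩
    · exact NullOsserman.Model.isNullJordanOsserman_constCurv hdim hA
    · exact NullOsserman.Model.isNullJordanOsserman_complex hdim hκ hJ hA
    · exact NullOsserman.Model.isNullJordanOsserman_paracomplex hdim hP hA
    · exact NullOsserman.Model.isNullJordanOsserman_paraquaternionic hdim hκ hΨ hA
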